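/- Work in simplicial type theory: intensional Martin-Löf dependent type theory with a cumulative hierarchy of universes $\mathcal U$, with $\Pi$- and $\Sigma$-types (with judgmental $\eta$), identity types, coproducts, the empty and unit types, the natural numbers and function extensionality, extended by - a layer of cubes (finite products of a directed interval $\mathbb 2$) and a layer of topes (formulas built from $\top,\bot,\wedge,\vee$, equality of cube terms and $\le$ on $\mathbb 2$, governed by intuitionistic logic and the axioms that $\le$ is a total order on $\mathbb 2$ with distinct least element $0$ and greatest element $1$), with elimination of $\bot$ and $\vee$ into types; - extension types $\left\langle \prod_{t:I\mid\psi} A(t)\,\middle|^{\varphi}_{a}\right\rangle$ (for topes $\varphi\vdash\psi$ on a cube $I$): the type of functions $t\mapsto f(t):A(t)$ on the shape $\{t:I\mid\psi\}$ with $f(t)\equiv a(t)$ judgmentally on $\{t:I\mid\varphi\}$; and relative function extensionality: an extension type of a family of contractible types is contractible. For a type $A$ and $x,y:A$ let $\hom_A(x,y)$ be the type of $f:\mathbb 2\to A$ with $f(0)\equiv x$, $f(1)\equiv y$; let $\mathrm{id}_x:\hom_A(x,x)$ be the constant function at $x$. For $f:\hom_A(x,y)$, $g:\hom_A(y,z)$,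 $h:\hom_A(x,z)$ let $\hom^2_A(f,g;h)$ be the type of maps $\{(t_1,t_2):\mathbb 2\times\mathbb 2\mid t_2\le t_1\}\to A$ which are $f(t_1)$ on $t_2\equiv 0$, $g(t_2)$ on $t_1\equiv 1$ and $h(t_1)$ on $t_1\equiv t_2$. The type $A$ is a *Segal type* if for all $x,y,z:A$, $f:\hom_A(x,y)$ and $g:\hom_A(y,z)$ the type $\sum_{h:\hom_A(x,z)}\hom^2_A(f,g;h)$ is contractible. For $C:A\to\mathcal U$, $f:\hom_A(x,y)$, $u:C(x)$ and $v:C(y)$ let $\hom_{C(f)}(u,v)$ be the type of dependent functions $k:\prod_{t:\mathbb 2}C(f(t))$ with $k(0)\equiv u$, $k(1)\equiv v$. The family $C$ is *covariant* if for all $x,y:A$, $f:\hom_A(x,y)$ and $u:C(x)$ the type $\sum_{v:C(y)}\hom_{C(f)}(u,v)$ is contractible; then $f_*u:C(y)$ denotes the first component of its center of contraction. **Theorem (Yoneda lemma).** \label{thm:yoneda} Let $A$ be a Segal type, $C:A\to\mathcal U$ a covariant family and $a:A$ (all in an arbitrary context, and with $A$ and the values of $C$ in arbitrary universes of the hierarchy).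 Then the maps $$\mathsf{evid}^C_a:=\lambda\varphi.\,\varphi(a,\mathrm{id}_a)\;:\;\Big(\prod_{x:A}\big(\hom_A(a,x)\to C(x)\big)\Big)\to C(a),$$ $$\mathsf{yon}^C_a:=\lambda u.\,\lambda x.\,\lambda f.\,f_*u\;:\;C(a)\to\prod_{x:A}\big(\hom_A(a,x)\to C(x)\big)$$ are inverse equivalences: the types $\prod_{\varphi}\,\mathsf{yon}^C_a(\mathsf{evid}^C_a(\varphi))=\varphi$ and $\prod_{u:C(a)}\,\mathsf{evid}^C_a(\mathsf{yon}^C_a(u))=u$ are inhabited, and $\mathsf{evid}^C_a$ and $\mathsf{yon}^C_a$ are both equivalences. -/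

import Mathlib

/-! Type theory with shapes over a strict interval, as a formal system: a cube layer, a tope layer
and a layer of intensional dependent type theory with extension types, with de Bruijn indices
(cube variables and term variables are numbered separately, the newest variable being `0`). -/

namespace STT

/-! ### The cube layer -/

/-- Cubes: finite products of the directed interval `two`. -/
inductive Cube : Type
  | one : Cube
  | two : Cube
  | prod : Cube → Cube → Cube

/-- Raw terms of the cube layer. -/
inductive CTm : Type
  | var : ℕ → CTm
  | star : CTm
  | pair : CTm → CTm → CTm
  | fst : CTm → CTm
  | snd : CTm → CTm
  | zero : CTm
  | one : CTm

/-- Adding a first element to a sequence (used for substitutions). -/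
def scons {α : Type} (x : α) (σ : ℕ → α) : ℕ → α
  | 0 => x
  | n + 1 => σ n

/-- A renaming under a binder. -/
def upRen (ρ : ℕ → ℕ) : ℕ → ℕ := scons 0 (fun n => ρ n + 1)

/-- Simultaneous substitution in cube terms. -/
def CTm.subst (σ : ℕ → CTm) : CTm → CTm
  | .var n => σ n
  | .star => .star
  | .pair s t => .pair (s.subst σ) (t.subst σ)
  | .fst t => .fst (t.subst σ)
  | .snd t => .snd (t.subst σ)
  | .zero => .zero
  | .one => .one

/-- Renaming in cube terms. -/
def CTm.ren (ρ : ℕ → ℕ) (t : CTm) : CTm := t.subst (fun n => .var (ρ n))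

/-- A cube substitution under a cube binder. -/
def upCube (σ : ℕ → CTm) : ℕ → CTm := scons (.var 0) (fun n => (σ n).ren Nat.succ)

/-- The substitution `[s / x]` for the newest cube variable. -/
def instCube (s : CTm) : ℕ → CTm := scons s CTm.var

/-- `Ξ ⊢ t : I` in the cube layer. -/
inductive CubeHas : List Cube → CTm → Cube → Prop
  | var {Ξ n I} : Ξ[n]? = some I → CubeHas Ξ (.var n) I
  | star {Ξ} : CubeHas Ξ .star .one
  | pair {Ξ s t I J} : CubeHas Ξ s I → CubeHas Ξ t J → CubeHas Ξ (.pair s t) (.prod I J)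
  | fst {Ξ t I J} : CubeHas Ξ t (.prod I J) → CubeHas Ξ (.fst t) I
  | snd {Ξ t I J} : CubeHas Ξ t (.prod I J) → CubeHas Ξ (.snd t) J
  | zero {Ξ} : CubeHas Ξ .zero .two
  | one {Ξ} : CubeHas Ξ .one .two

/-! ### The tope layer -/

/-- Raw topes. -/
inductive Tope : Type
  | top : Tope
  | bot : Tope
  | and : Tope → Tope → Tope
  | or : Tope → Tope → Tope
  | eq : CTm → CTm → Tope
  | le : CTm → CTm → Tope

/-- Simultaneous substitution in topes. -/
def Tope.subst (σ : ℕ → CTm) : Tope → Tope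
  | .top => .top
  | .bot => .bot
  | .and φ ψ => .and (φ.subst σ) (ψ.subst σ)
  | .or φ ψ => .or (φ.subst σ) (ψ.subst σ)
  | .eq s t => .eq (s.subst σ) (t.subst σ)
  | .le s t => .le (s.subst σ) (t.subst σ)

/-- Renaming in topes. -/
def Tope.ren (ρ : ℕ → ℕ) (φ : Tope) : Tope := φ.subst (fun n => .var (ρ n))

/-- `Ξ ⊢ φ tope`. -/
inductive TopeWf : List Cube → Tope → Prop
  | top {Ξ} : TopeWf Ξ .top
  | bot {Ξ} : TopeWf Ξ .bot
  | and {Ξ φ ψ} : TopeWf Ξ φ → TopeWf Ξ ψ → TopeWf Ξ (.and φ ψ)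
  | or {Ξ φ ψ} : TopeWf Ξ φ → TopeWf Ξ ψ → TopeWf Ξ (.or φ ψ)
  | eq {Ξ s t I} : CubeHas Ξ s I → CubeHas Ξ t I → TopeWf Ξ (.eq s t)
  | le {Ξ s t} : CubeHas Ξ s .two → CubeHas Ξ t .two → TopeWf Ξ (.le s t)

/-- `Ξ ∣ Φ ⊢ φ`: intuitionistic coherent logic with equality and the axioms of a strict interval
(a total order with distinct least element `0` and greatest element `1`). -/
inductive Entails : List Cube → List Tope → Tope → Prop
  | hyp {Ξ Φ φ} : φ ∈ Φ → Entails Ξ Φ φ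
  | topI {Ξ Φ} : Entails Ξ Φ .top
  | botE {Ξ Φ ψ} : TopeWf Ξ ψ → Entails Ξ Φ .bot → Entails Ξ Φ ψ
  | andI {Ξ Φ φ ψ} : Entails Ξ Φ φ → Entails Ξ Φ ψ → Entails Ξ Φ (.and φ ψ)
  | andE₁ {Ξ Φ φ ψ} : Entails Ξ Φ (.and φ ψ) → Entails Ξ Φ φ
  | andE₂ {Ξ Φ φ ψ} : Entails Ξ Φ (.and φ ψ) → Entails Ξ Φ ψ
  | orI₁ {Ξ Φ φ ψ} : TopeWf Ξ ψ → Entails Ξ Φ φ → Entails Ξ Φ (.or φ ψ)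
  | orI₂ {Ξ Φ φ ψ} : TopeWf Ξ φ → Entails Ξ Φ ψ → Entails Ξ Φ (.or φ ψ)
  | orE {Ξ Φ φ ψ χ} : Entails Ξ (φ :: Φ) χ → Entails Ξ (ψ :: Φ) χ → Entails Ξ Φ (.or φ ψ) →
      Entails Ξ Φ χ
  | eqRefl {Ξ Φ s I} : CubeHas Ξ s I → Entails Ξ Φ (.eq s s)
  | eqSymm {Ξ Φ s t} : Entails Ξ Φ (.eq s t) → Entails Ξ Φ (.eq t s)
  | eqTrans {Ξ Φ s t v} : Entails Ξ Φ (.eq s t) → Entails Ξ Φ (.eq t v) → Entails Ξ Φ (.eq s v)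
  | eqSubst {Ξ Φ s t I ψ} : CubeHas Ξ s I → CubeHas Ξ t I → Entails Ξ Φ (.eq s t) →
      TopeWf (I :: Ξ) ψ → Entails Ξ Φ (ψ.subst (instCube s)) → Entails Ξ Φ (ψ.subst (instCube t))
  | starEta {Ξ Φ t} : CubeHas Ξ t .one → Entails Ξ Φ (.eq t .star)
  | fstBeta {Ξ Φ s t I J} : CubeHas Ξ s I → CubeHas Ξ t J →
      Entails Ξ Φ (.eq (.fst (.pair s t)) s)
  | sndBeta {Ξ Φ s t I J} : CubeHas Ξ s I → CubeHas Ξ t J →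
      Entails Ξ Φ (.eq (.snd (.pair s t)) t)
  | pairEta {Ξ Φ t I J} : CubeHas Ξ t (.prod I J) →
      Entails Ξ Φ (.eq t (.pair (.fst t) (.snd t)))
  | leRefl {Ξ Φ x} : CubeHas Ξ x .two → Entails Ξ Φ (.le x x)
  | leTrans {Ξ Φ x y z} : Entails Ξ Φ (.le x y) → Entails Ξ Φ (.le y z) → Entails Ξ Φ (.le x z)
  | leAntisymm {Ξ Φ x y} : Entails Ξ Φ (.le x y) → Entails Ξ Φ (.le y x) → Entails Ξ Φ (.eq x y)
  | leTotal {Ξ Φ x y} : CubeHas Ξ x .two → CubeHas Ξ y .two →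
      Entails Ξ Φ (.or (.le x y) (.le y x))
  | zeroLe {Ξ Φ x} : CubeHas Ξ x .two → Entails Ξ Φ (.le .zero x)
  | leOne {Ξ Φ x} : CubeHas Ξ x .two → Entails Ξ Φ (.le x .one)
  | zeroNeOne {Ξ Φ} : Entails Ξ Φ (.eq .zero .one) → Entails Ξ Φ .bot

/-! ### The type layer: raw syntax -/

/-- Raw terms and types of the third layer. Types are the terms of a universe. The comments say
which arguments bind variables; the topes in `ext` and `elam` live in the context consisting of the
bound cube variable alone. -/
inductive Tm : Type
  | var : ℕ → Tm
  | univ : ℕ → Tm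
  /-- `pi A B` is `Π (x : A), B`, with `x` bound in `B`; `lam A b` is `λ (x : A), b`. -/
  | pi : Tm → Tm → Tm
  | lam : Tm → Tm → Tm
  | app : Tm → Tm → Tm
  /-- `sigma A B` is `Σ (x : A), B`, with `x` bound in `B`. -/
  | sigma : Tm → Tm → Tm
  | pair : Tm → Tm → Tm
  | fst : Tm → Tm
  | snd : Tm → Tm
  /-- `id A a b` is the identity type `a =_A b`. -/
  | id : Tm → Tm → Tm → Tm
  | refl : Tm → Tm
  /-- `idrec C d p`: path induction on `p : a = b`, with `y` and `q : a = y` bound in `C`. -/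
  | idrec : Tm → Tm → Tm → Tm
  | empty : Tm
  /-- `emptyrec C e`, with one variable bound in `C`. -/
  | emptyrec : Tm → Tm → Tm
  | unit : Tm
  | star : Tm
  /-- `unitrec C c e`, with one variable bound in `C`. -/
  | unitrec : Tm → Tm → Tm → Tm
  | sum : Tm → Tm → Tm
  | inl : Tm → Tm
  | inr : Tm → Tm
  /-- `sumrec C l r e`, with one variable bound in each of `C`, `l`, `r`. -/
  | sumrec : Tm → Tm → Tm → Tm → Tm
  | nat : Tm
  | zero : Tm
  | succ : Tm → Tm
  /-- `natrec C z s n`, with one variable bound in `C` and two in `s`. -/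
  | natrec : Tm → Tm → Tm → Tm → Tm
  | recBot : Tm
  /-- `recOr φ ψ a b` is `rec_∨^{φ,ψ}(a, b)`. -/
  | recOr : Tope → Tope → Tm → Tm → Tm
  /-- `ext I ψ A φ a` is the extension type `⟨Π (t : I | ψ), A |^φ_a⟩`, with the cube variable `t`
  bound in `ψ`, `A`, `φ`, `a`. -/
  | ext : Cube → Tope → Tm → Tope → Tm → Tm
  /-- `elam I ψ b` is `λ (t : I | ψ), b`, with the cube variable `t` bound in `ψ`, `b`. -/
  | elam : Cube → Tope → Tm → Tm
  | eapp : Tm → CTm → Tm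
  /-- `funext f g h`: the function extensionality axiom. -/
  | funext : Tm → Tm → Tm → Tm
  /-- `extfunext I ψ A φ a c`: the relative function extensionality axiom, with one cube variable
  bound in `ψ`, `A`, `φ`, `a`, `c`. -/
  | extfunext : Cube → Tope → Tm → Tope → Tm → Tm → Tm

/-- Renaming of cube variables along `κ` and of term variables along `ρ`. -/
def Tm.ren (κ ρ : ℕ → ℕ) : Tm → Tm
  | .var n => .var (ρ n)
  | .univ i => .univ i
  | .pi A B => .pi (A.ren κ ρ) (B.ren κ (upRen ρ))
  | .lam A b => .lam (A.ren κ ρ) (b.ren κ (upRen ρ))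
  | .app f a => .app (f.ren κ ρ) (a.ren κ ρ)
  | .sigma A B => .sigma (A.ren κ ρ) (B.ren κ (upRen ρ))
  | .pair a b => .pair (a.ren κ ρ) (b.ren κ ρ)
  | .fst p => .fst (p.ren κ ρ)
  | .snd p => .snd (p.ren κ ρ)
  | .id A a b => .id (A.ren κ ρ) (a.ren κ ρ) (b.ren κ ρ)
  | .refl a => .refl (a.ren κ ρ)
  | .idrec C d p => .idrec (C.ren κ (upRen (upRen ρ))) (d.ren κ ρ) (p.ren κ ρ)
  | .empty => .empty
  | .emptyrec C e => .emptyrec (C.ren κ (upRen ρ)) (e.ren κ ρ)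
  | .unit => .unit
  | .star => .star
  | .unitrec C c e => .unitrec (C.ren κ (upRen ρ)) (c.ren κ ρ) (e.ren κ ρ)
  | .sum A B => .sum (A.ren κ ρ) (B.ren κ ρ)
  | .inl a => .inl (a.ren κ ρ)
  | .inr b => .inr (b.ren κ ρ)
  | .sumrec C l r e => .sumrec (C.ren κ (upRen ρ)) (l.ren κ (upRen ρ)) (r.ren κ (upRen ρ))
      (e.ren κ ρ)
  | .nat => .nat
  | .zero => .zero
  | .succ n => .succ (n.ren κ ρ)
  | .natrec C z s n => .natrec (C.ren κ (upRen ρ)) (z.ren κ ρ) (s.ren κ (upRen (upRen ρ)))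
      (n.ren κ ρ)
  | .recBot => .recBot
  | .recOr φ ψ a b => .recOr (φ.ren κ) (ψ.ren κ) (a.ren κ ρ) (b.ren κ ρ)
  | .ext I ψ A φ a => .ext I ψ (A.ren (upRen κ) ρ) φ (a.ren (upRen κ) ρ)
  | .elam I ψ b => .elam I ψ (b.ren (upRen κ) ρ)
  | .eapp f s => .eapp (f.ren κ ρ) (s.ren κ)
  | .funext f g h => .funext (f.ren κ ρ) (g.ren κ ρ) (h.ren κ ρ)
  | .extfunext I ψ A φ a c => .extfunext I ψ (A.ren (upRen κ) ρ) φ (a.ren (upRen κ) ρ)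
      (c.ren (upRen κ) ρ)

/-- Weakening by `n` term variables. -/
def Tm.wk (n : ℕ) (a : Tm) : Tm := a.ren (fun k => k) (fun k => k + n)

/-- Weakening by a cube variable. -/
def Tm.wkCube (a : Tm) : Tm := a.ren Nat.succ (fun k => k)

/-- A term substitution under a term binder. -/
def upTm (σ : ℕ → Tm) : ℕ → Tm := scons (.var 0) (fun n => (σ n).wk 1)

/-- Simultaneous substitution of cube terms for cube variables and of terms for term variables. -/
def Tm.subst (κ : ℕ → CTm) (σ : ℕ → Tm) : Tm → Tm
  | .var n => σ n
  | .univ i => .univ i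
  | .pi A B => .pi (A.subst κ σ) (B.subst κ (upTm σ))
  | .lam A b => .lam (A.subst κ σ) (b.subst κ (upTm σ))
  | .app f a => .app (f.subst κ σ) (a.subst κ σ)
  | .sigma A B => .sigma (A.subst κ σ) (B.subst κ (upTm σ))
  | .pair a b => .pair (a.subst κ σ) (b.subst κ σ)
  | .fst p => .fst (p.subst κ σ)
  | .snd p => .snd (p.subst κ σ)
  | .id A a b => .id (A.subst κ σ) (a.subst κ σ) (b.subst κ σ)
  | .refl a => .refl (a.subst κ σ)
  | .idrec C d p => .idrec (C.subst κ (upTm (upTm σ))) (d.subst κ σ) (p.subst κ σ)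
  | .empty => .empty
  | .emptyrec C e => .emptyrec (C.subst κ (upTm σ)) (e.subst κ σ)
  | .unit => .unit
  | .star => .star
  | .unitrec C c e => .unitrec (C.subst κ (upTm σ)) (c.subst κ σ) (e.subst κ σ)
  | .sum A B => .sum (A.subst κ σ) (B.subst κ σ)
  | .inl a => .inl (a.subst κ σ)
  | .inr b => .inr (b.subst κ σ)
  | .sumrec C l r e => .sumrec (C.subst κ (upTm σ)) (l.subst κ (upTm σ)) (r.subst κ (upTm σ))
      (e.subst κ σ)
  | .nat => .nat
  | .zero => .zero
  | .succ n => .succ (n.subst κ σ)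
  | .natrec C z s n => .natrec (C.subst κ (upTm σ)) (z.subst κ σ) (s.subst κ (upTm (upTm σ)))
      (n.subst κ σ)
  | .recBot => .recBot
  | .recOr φ ψ a b => .recOr (φ.subst κ) (ψ.subst κ) (a.subst κ σ) (b.subst κ σ)
  | .ext I ψ A φ a => .ext I ψ (A.subst (upCube κ) (fun n => (σ n).wkCube)) φ
      (a.subst (upCube κ) (fun n => (σ n).wkCube))
  | .elam I ψ b => .elam I ψ (b.subst (upCube κ) (fun n => (σ n).wkCube))
  | .eapp f s => .eapp (f.subst κ σ) (s.subst κ)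
  | .funext f g h => .funext (f.subst κ σ) (g.subst κ σ) (h.subst κ σ)
  | .extfunext I ψ A φ a c => .extfunext I ψ (A.subst (upCube κ) (fun n => (σ n).wkCube)) φ
      (a.subst (upCube κ) (fun n => (σ n).wkCube)) (c.subst (upCube κ) (fun n => (σ n).wkCube))

/-- `B.inst a` is `B[a / x]`, for `x` the newest term variable. -/
def Tm.inst (B a : Tm) : Tm := B.subst CTm.var (scons a Tm.var)

/-- `C.inst₂ b p` is `C[b / y, p / q]`, for `q` the newest and `y` the second newest variable. -/
def Tm.inst₂ (C b p : Tm) : Tm := C.subst CTm.var (scons p (scons b Tm.var))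

/-- `A.cinst s` is `A[s / t]`, for `t` the newest cube variable. -/
def Tm.cinst (A : Tm) (s : CTm) : Tm := A.subst (instCube s) Tm.var

/-- `Φ, ψ` in the context extended by a cube variable, for a tope `ψ` about that variable. -/
def extTopes (Φ : List Tope) (ψ : Tope) : List Tope := ψ :: Φ.map (Tope.ren Nat.succ)

/-- `Γ` weakened by a cube variable. -/
def wkCtx (Γ : List Tm) : List Tm := Γ.map Tm.wkCube

/-- The type `A → B`. -/
def arrow (A B : Tm) : Tm := .pi A (B.wk 1)

/-- `isContr A := Σ (x : A), Π (y : A), x = y`. -/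
def isContr (A : Tm) : Tm := .sigma A (.pi (A.wk 1) (.id (A.wk 2) (.var 1) (.var 0)))

/-! ### The type layer: judgments -/

mutual

/-- `Ξ ∣ Φ ⊢ Γ ctx`. -/
inductive Ctx : List Cube → List Tope → List Tm → Prop
  | nil {Ξ Φ} : (∀ φ ∈ Φ, TopeWf Ξ φ) → Ctx Ξ Φ []
  | cons {Ξ Φ Γ A i} : Ctx Ξ Φ Γ → JEq Ξ Φ Γ A A (.univ i) → Ctx Ξ Φ (A :: Γ)

/-- `JEq Ξ Φ Γ a b A` is the judgmental equality `Ξ ∣ Φ ∣ Γ ⊢ a ≡ b : A`. The typing judgment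
`Ξ ∣ Φ ∣ Γ ⊢ a : A` is its diagonal `a ≡ a : A`, so that each introduction, formation or
elimination rule is stated together with its congruence rule; `Ξ ∣ Φ ∣ Γ ⊢ A type` means that
`A : univ i` for some `i`. -/
inductive JEq : List Cube → List Tope → List Tm → Tm → Tm → Tm → Prop
  /- Equivalence and conversion. -/
  | symm {Ξ Φ Γ a b A} : JEq Ξ Φ Γ a b A → JEq Ξ Φ Γ b a A
  | trans {Ξ Φ Γ a b c A} : JEq Ξ Φ Γ a b A → JEq Ξ Φ Γ b c A → JEq Ξ Φ Γ a c A
  | conv {Ξ Φ Γ a b A B i} : JEq Ξ Φ Γ a b A → JEq Ξ Φ Γ A B (.univ i) → JEq Ξ Φ Γ a b B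
  /- Structural rules: simultaneous substitution, which contains weakening, contraction,
  exchange, substitution and cut for all three layers. -/
  | var {Ξ Φ Γ n A} : Ctx Ξ Φ Γ → Γ[n]? = some A →
      JEq Ξ Φ Γ (.var n) (.var n) (A.wk (n + 1))
  | subst {Ξ Φ Γ Ξ' Φ' Γ' κ σ a b A} : Ctx Ξ' Φ' Γ' →
      (∀ n I, Ξ[n]? = some I → CubeHas Ξ' (κ n) I) →
      (∀ φ ∈ Φ, Entails Ξ' Φ' (φ.subst κ)) →
      (∀ n B, Γ[n]? = some B →
        JEq Ξ' Φ' Γ' (σ n) (σ n) ((B.wk (n + 1)).subst κ σ)) →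
      JEq Ξ Φ Γ a b A → JEq Ξ' Φ' Γ' (a.subst κ σ) (b.subst κ σ) (A.subst κ σ)
  /- Tope equality behaves like judgmental equality. -/
  | topeEq {Ξ Φ Γ s t I a A} : CubeHas Ξ s I → CubeHas Ξ t I → Entails Ξ Φ (.eq s t) →
      JEq (I :: Ξ) (Φ.map (Tope.ren Nat.succ)) Γ a a A →
      JEq Ξ Φ (Γ.map (fun B => B.cinst s)) (a.cinst s) (a.cinst t) (A.cinst s)
  /- Type elimination for `⊥` and `∨`. -/
  | recBot {Ξ Φ Γ A i} : Entails Ξ Φ .bot → JEq Ξ Φ Γ A A (.univ i) →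
      JEq Ξ Φ Γ .recBot .recBot A
  | recBotEta {Ξ Φ Γ a A} : Entails Ξ Φ .bot → JEq Ξ Φ Γ a a A → JEq Ξ Φ Γ a .recBot A
  | recOr {Ξ Φ Γ φ ψ a a' b b' A i} : Entails Ξ Φ (.or φ ψ) → JEq Ξ Φ Γ A A (.univ i) →
      JEq Ξ (φ :: Φ) Γ a a' A → JEq Ξ (ψ :: Φ) Γ b b' A → JEq Ξ (.and φ ψ :: Φ) Γ a b A →
      JEq Ξ Φ Γ (.recOr φ ψ a b) (.recOr φ ψ a' b') A
  | recOrBeta₁ {Ξ Φ Γ φ ψ a b A i} : Entails Ξ Φ (.or φ ψ) → JEq Ξ Φ Γ A A (.univ i) →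
      JEq Ξ (φ :: Φ) Γ a a A → JEq Ξ (ψ :: Φ) Γ b b A → JEq Ξ (.and φ ψ :: Φ) Γ a b A →
      JEq Ξ (φ :: Φ) Γ (.recOr φ ψ a b) a A
  | recOrBeta₂ {Ξ Φ Γ φ ψ a b A i} : Entails Ξ Φ (.or φ ψ) → JEq Ξ Φ Γ A A (.univ i) →
      JEq Ξ (φ :: Φ) Γ a a A → JEq Ξ (ψ :: Φ) Γ b b A → JEq Ξ (.and φ ψ :: Φ) Γ a b A →
      JEq Ξ (ψ :: Φ) Γ (.recOr φ ψ a b) b A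
  | recOrEta {Ξ Φ Γ φ ψ a A} : Entails Ξ Φ (.or φ ψ) → JEq Ξ Φ Γ a a A →
      JEq Ξ Φ Γ a (.recOr φ ψ a a) A
  /- Universes (Russell style, cumulative). -/
  | univ {Ξ Φ Γ i} : Ctx Ξ Φ Γ → JEq Ξ Φ Γ (.univ i) (.univ i) (.univ (i + 1))
  | cumul {Ξ Φ Γ A B i j} : i ≤ j → JEq Ξ Φ Γ A B (.univ i) → JEq Ξ Φ Γ A B (.univ j)
  /- Dependent functions. -/
  | pi {Ξ Φ Γ A A' B B' i} : JEq Ξ Φ Γ A A' (.univ i) → JEq Ξ Φ (A :: Γ) B B' (.univ i) →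
      JEq Ξ Φ Γ (.pi A B) (.pi A' B') (.univ i)
  | lam {Ξ Φ Γ A A' B b b' i} : JEq Ξ Φ Γ A A' (.univ i) → JEq Ξ Φ (A :: Γ) b b' B →
      JEq Ξ Φ Γ (.lam A b) (.lam A' b') (.pi A B)
  | app {Ξ Φ Γ A B f f' a a'} : JEq Ξ Φ Γ f f' (.pi A B) → JEq Ξ Φ Γ a a' A →
      JEq Ξ Φ Γ (.app f a) (.app f' a') (B.inst a)
  | piBeta {Ξ Φ Γ A B b a} : JEq Ξ Φ (A :: Γ) b b B → JEq Ξ Φ Γ a a A →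
      JEq Ξ Φ Γ (.app (.lam A b) a) (b.inst a) (B.inst a)
  | piEta {Ξ Φ Γ A B f} : JEq Ξ Φ Γ f f (.pi A B) →
      JEq Ξ Φ Γ f (.lam A (.app (f.wk 1) (.var 0))) (.pi A B)
  /- Dependent pairs. -/
  | sigma {Ξ Φ Γ A A' B B' i} : JEq Ξ Φ Γ A A' (.univ i) → JEq Ξ Φ (A :: Γ) B B' (.univ i) →
      JEq Ξ Φ Γ (.sigma A B) (.sigma A' B') (.univ i)
  | pair {Ξ Φ Γ A B a a' b b' i} : JEq Ξ Φ (A :: Γ) B B (.univ i) → JEq Ξ Φ Γ a a' A →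
      JEq Ξ Φ Γ b b' (B.inst a) → JEq Ξ Φ Γ (.pair a b) (.pair a' b') (.sigma A B)
  | fst {Ξ Φ Γ A B p p'} : JEq Ξ Φ Γ p p' (.sigma A B) → JEq Ξ Φ Γ (.fst p) (.fst p') A
  | snd {Ξ Φ Γ A B p p'} : JEq Ξ Φ Γ p p' (.sigma A B) →
      JEq Ξ Φ Γ (.snd p) (.snd p') (B.inst (.fst p))
  | fstBeta {Ξ Φ Γ A B a b i} : JEq Ξ Φ (A :: Γ) B B (.univ i) → JEq Ξ Φ Γ a a A →
      JEq Ξ Φ Γ b b (B.inst a) → JEq Ξ Φ Γ (.fst (.pair a b)) a A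
  | sndBeta {Ξ Φ Γ A B a b i} : JEq Ξ Φ (A :: Γ) B B (.univ i) → JEq Ξ Φ Γ a a A →
      JEq Ξ Φ Γ b b (B.inst a) → JEq Ξ Φ Γ (.snd (.pair a b)) b (B.inst a)
  | sigmaEta {Ξ Φ Γ A B p} : JEq Ξ Φ Γ p p (.sigma A B) →
      JEq Ξ Φ Γ p (.pair (.fst p) (.snd p)) (.sigma A B)
  /- Identity types. -/
  | id {Ξ Φ Γ A A' a a' b b' i} : JEq Ξ Φ Γ A A' (.univ i) → JEq Ξ Φ Γ a a' A →
      JEq Ξ Φ Γ b b' A → JEq Ξ Φ Γ (.id A a b) (.id A' a' b') (.univ i)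
  | refl {Ξ Φ Γ A a a'} : JEq Ξ Φ Γ a a' A → JEq Ξ Φ Γ (.refl a) (.refl a') (.id A a a)
  | idrec {Ξ Φ Γ A a b C C' d d' p p' i} : JEq Ξ Φ Γ a a A →
      JEq Ξ Φ (.id (A.wk 1) (a.wk 1) (.var 0) :: A :: Γ) C C' (.univ i) →
      JEq Ξ Φ Γ d d' (C.inst₂ a (.refl a)) → JEq Ξ Φ Γ p p' (.id A a b) →
      JEq Ξ Φ Γ (.idrec C d p) (.idrec C' d' p') (C.inst₂ b p)
  | idBeta {Ξ Φ Γ A a C d i} : JEq Ξ Φ Γ a a A →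
      JEq Ξ Φ (.id (A.wk 1) (a.wk 1) (.var 0) :: A :: Γ) C C (.univ i) →
      JEq Ξ Φ Γ d d (C.inst₂ a (.refl a)) →
      JEq Ξ Φ Γ (.idrec C d (.refl a)) d (C.inst₂ a (.refl a))
  /- Empty type, unit type, coproducts, natural numbers. -/
  | empty {Ξ Φ Γ i} : Ctx Ξ Φ Γ → JEq Ξ Φ Γ .empty .empty (.univ i)
  | emptyrec {Ξ Φ Γ C C' e e' i} : JEq Ξ Φ (.empty :: Γ) C C' (.univ i) →
      JEq Ξ Φ Γ e e' .empty → JEq Ξ Φ Γ (.emptyrec C e) (.emptyrec C' e') (C.inst e)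
  | unit {Ξ Φ Γ i} : Ctx Ξ Φ Γ → JEq Ξ Φ Γ .unit .unit (.univ i)
  | star {Ξ Φ Γ} : Ctx Ξ Φ Γ → JEq Ξ Φ Γ .star .star .unit
  | unitrec {Ξ Φ Γ C C' c c' e e' i} : JEq Ξ Φ (.unit :: Γ) C C' (.univ i) →
      JEq Ξ Φ Γ c c' (C.inst .star) → JEq Ξ Φ Γ e e' .unit →
      JEq Ξ Φ Γ (.unitrec C c e) (.unitrec C' c' e') (C.inst e)
  | unitBeta {Ξ Φ Γ C c i} : JEq Ξ Φ (.unit :: Γ) C C (.univ i) →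
      JEq Ξ Φ Γ c c (C.inst .star) → JEq Ξ Φ Γ (.unitrec C c .star) c (C.inst .star)
  | sum {Ξ Φ Γ A A' B B' i} : JEq Ξ Φ Γ A A' (.univ i) → JEq Ξ Φ Γ B B' (.univ i) →
      JEq Ξ Φ Γ (.sum A B) (.sum A' B') (.univ i)
  | inl {Ξ Φ Γ A B a a' i} : JEq Ξ Φ Γ B B (.univ i) → JEq Ξ Φ Γ a a' A →
      JEq Ξ Φ Γ (.inl a) (.inl a') (.sum A B)
  | inr {Ξ Φ Γ A B b b' i} : JEq Ξ Φ Γ A A (.univ i) → JEq Ξ Φ Γ b b' B →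
      JEq Ξ Φ Γ (.inr b) (.inr b') (.sum A B)
  | sumrec {Ξ Φ Γ A B C C' l l' r r' e e' i} : JEq Ξ Φ (.sum A B :: Γ) C C' (.univ i) →
      JEq Ξ Φ (A :: Γ) l l' (C.subst CTm.var (scons (.inl (.var 0)) (fun n => .var (n + 1)))) →
      JEq Ξ Φ (B :: Γ) r r' (C.subst CTm.var (scons (.inr (.var 0)) (fun n => .var (n + 1)))) →
      JEq Ξ Φ Γ e e' (.sum A B) →
      JEq Ξ Φ Γ (.sumrec C l r e) (.sumrec C' l' r' e') (C.inst e)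
  | sumBeta₁ {Ξ Φ Γ A B C l r a i} : JEq Ξ Φ (.sum A B :: Γ) C C (.univ i) →
      JEq Ξ Φ (A :: Γ) l l (C.subst CTm.var (scons (.inl (.var 0)) (fun n => .var (n + 1)))) →
      JEq Ξ Φ (B :: Γ) r r (C.subst CTm.var (scons (.inr (.var 0)) (fun n => .var (n + 1)))) →
      JEq Ξ Φ Γ a a A → JEq Ξ Φ Γ (.sumrec C l r (.inl a)) (l.inst a) (C.inst (.inl a))
  | sumBeta₂ {Ξ Φ Γ A B C l r b i} : JEq Ξ Φ (.sum A B :: Γ) C C (.univ i) →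
      JEq Ξ Φ (A :: Γ) l l (C.subst CTm.var (scons (.inl (.var 0)) (fun n => .var (n + 1)))) →
      JEq Ξ Φ (B :: Γ) r r (C.subst CTm.var (scons (.inr (.var 0)) (fun n => .var (n + 1)))) →
      JEq Ξ Φ Γ b b B → JEq Ξ Φ Γ (.sumrec C l r (.inr b)) (r.inst b) (C.inst (.inr b))
  | nat {Ξ Φ Γ i} : Ctx Ξ Φ Γ → JEq Ξ Φ Γ .nat .nat (.univ i)
  | zero {Ξ Φ Γ} : Ctx Ξ Φ Γ → JEq Ξ Φ Γ .zero .zero .nat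
  | succ {Ξ Φ Γ n n'} : JEq Ξ Φ Γ n n' .nat → JEq Ξ Φ Γ (.succ n) (.succ n') .nat
  | natrec {Ξ Φ Γ C C' z z' s s' n n' i} : JEq Ξ Φ (.nat :: Γ) C C' (.univ i) →
      JEq Ξ Φ Γ z z' (C.inst .zero) →
      JEq Ξ Φ (C :: .nat :: Γ) s s'
        (C.subst CTm.var (scons (.succ (.var 1)) (fun k => .var (k + 2)))) →
      JEq Ξ Φ Γ n n' .nat →
      JEq Ξ Φ Γ (.natrec C z s n) (.natrec C' z' s' n') (C.inst n)
  | natBeta₀ {Ξ Φ Γ C z s i} : JEq Ξ Φ (.nat :: Γ) C C (.univ i) →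
      JEq Ξ Φ Γ z z (C.inst .zero) →
      JEq Ξ Φ (C :: .nat :: Γ) s s
        (C.subst CTm.var (scons (.succ (.var 1)) (fun k => .var (k + 2)))) →
      JEq Ξ Φ Γ (.natrec C z s .zero) z (C.inst .zero)
  | natBeta₁ {Ξ Φ Γ C z s n i} : JEq Ξ Φ (.nat :: Γ) C C (.univ i) →
      JEq Ξ Φ Γ z z (C.inst .zero) →
      JEq Ξ Φ (C :: .nat :: Γ) s s
        (C.subst CTm.var (scons (.succ (.var 1)) (fun k => .var (k + 2)))) →
      JEq Ξ Φ Γ n n .nat →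
      JEq Ξ Φ Γ (.natrec C z s (.succ n)) (s.inst₂ n (.natrec C z s n)) (C.inst (.succ n))
  /- Extension types. -/
  | ext {Ξ Φ Γ I φ ψ A A' a a' i} : TopeWf [I] φ → TopeWf [I] ψ → Entails [I] [φ] ψ →
      Ctx Ξ Φ Γ → JEq (I :: Ξ) (extTopes Φ ψ) (wkCtx Γ) A A' (.univ i) →
      JEq (I :: Ξ) (extTopes Φ φ) (wkCtx Γ) a a' A →
      JEq Ξ Φ Γ (.ext I ψ A φ a) (.ext I ψ A' φ a') (.univ i)
  | elam {Ξ Φ Γ I φ ψ A a b b' i} : TopeWf [I] φ → TopeWf [I] ψ → Entails [I] [φ] ψ →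
      Ctx Ξ Φ Γ → JEq (I :: Ξ) (extTopes Φ ψ) (wkCtx Γ) A A (.univ i) →
      JEq (I :: Ξ) (extTopes Φ φ) (wkCtx Γ) a a A →
      JEq (I :: Ξ) (extTopes Φ ψ) (wkCtx Γ) b b' A →
      JEq (I :: Ξ) (extTopes Φ φ) (wkCtx Γ) b a A →
      JEq Ξ Φ Γ (.elam I ψ b) (.elam I ψ b') (.ext I ψ A φ a)
  | eapp {Ξ Φ Γ I φ ψ A a f f' s} : JEq Ξ Φ Γ f f' (.ext I ψ A φ a) → CubeHas Ξ s I →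
      Entails Ξ Φ (ψ.subst (instCube s)) → JEq Ξ Φ Γ (.eapp f s) (.eapp f' s) (A.cinst s)
  | extBoundary {Ξ Φ Γ I φ ψ A a f s} : JEq Ξ Φ Γ f f (.ext I ψ A φ a) → CubeHas Ξ s I →
      Entails Ξ Φ (φ.subst (instCube s)) → JEq Ξ Φ Γ (.eapp f s) (a.cinst s) (A.cinst s)
  | extBeta {Ξ Φ Γ I φ ψ A a b i s} : TopeWf [I] φ → TopeWf [I] ψ → Entails [I] [φ] ψ →
      Ctx Ξ Φ Γ → JEq (I :: Ξ) (extTopes Φ ψ) (wkCtx Γ) A A (.univ i) →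
      JEq (I :: Ξ) (extTopes Φ φ) (wkCtx Γ) a a A →
      JEq (I :: Ξ) (extTopes Φ ψ) (wkCtx Γ) b b A →
      JEq (I :: Ξ) (extTopes Φ φ) (wkCtx Γ) b a A →
      CubeHas Ξ s I → Entails Ξ Φ (ψ.subst (instCube s)) →
      JEq Ξ Φ Γ (.eapp (.elam I ψ b) s) (b.cinst s) (A.cinst s)
  | extEta {Ξ Φ Γ I φ ψ A a f} : JEq Ξ Φ Γ f f (.ext I ψ A φ a) →
      JEq Ξ Φ Γ f (.elam I ψ (.eapp f.wkCube (.var 0))) (.ext I ψ A φ a)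
  /- Function extensionality and relative function extensionality (the latter in the form: an
  extension type of a family of contractible types is contractible). -/
  | funext {Ξ Φ Γ A B f f' g g' h h'} : JEq Ξ Φ Γ f f' (.pi A B) → JEq Ξ Φ Γ g g' (.pi A B) →
      JEq Ξ Φ Γ h h' (.pi A (.id B (.app (f.wk 1) (.var 0)) (.app (g.wk 1) (.var 0)))) →
      JEq Ξ Φ Γ (.funext f g h) (.funext f' g' h') (.id (.pi A B) f g)
  | extfunext {Ξ Φ Γ I φ ψ A A' a a' c c' i} : TopeWf [I] φ → TopeWf [I] ψ →
      Entails [I] [φ] ψ → Ctx Ξ Φ Γ →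
      JEq (I :: Ξ) (extTopes Φ ψ) (wkCtx Γ) A A' (.univ i) →
      JEq (I :: Ξ) (extTopes Φ φ) (wkCtx Γ) a a' A →
      JEq (I :: Ξ) (extTopes Φ ψ) (wkCtx Γ) c c' (isContr A) →
      JEq Ξ Φ Γ (.extfunext I ψ A φ a c) (.extfunext I ψ A' φ a' c')
        (isContr (.ext I ψ A φ a))

end

/-- The typing judgment `Ξ ∣ Φ ∣ Γ ⊢ a : A`. -/
def HasType (Ξ : List Cube) (Φ : List Tope) (Γ : List Tm) (a A : Tm) : Prop := JEq Ξ Φ Γ a a A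

/-! ### Arrows, Segal types, covariant families -/

/-- The boundary of the 1-simplex: `0 ≡ t ∨ t ≡ 1`. -/
def bdry1 : Tope := .or (.eq .zero (.var 0)) (.eq (.var 0) .one)

/-- For terms `x`, `y`, the term `[x, y]` in the context of the boundary of the 1-simplex. -/
def endpoints (x y : Tm) : Tm :=
  .recOr (.eq .zero (.var 0)) (.eq (.var 0) .one) x.wkCube y.wkCube

/-- `hom_A(x, y)`: maps from the 1-simplex to `A` restricting to `[x, y]` on the boundary. -/
def hom (A x y : Tm) : Tm := .ext .two .top A.wkCube bdry1 (endpoints x y)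

/-- The identity arrow of `x`, constant at `x`. -/
def idArrow (x : Tm) : Tm := .elam .two .top x.wkCube

/-- The first coordinate `t₁` of the newest variable, of cube `𝟚 × 𝟚`. -/
def t₁ : CTm := .fst (.var 0)

/-- The second coordinate `t₂` of the newest variable, of cube `𝟚 × 𝟚`. -/
def t₂ : CTm := .snd (.var 0)

/-- The 2-simplex `{(t₁, t₂) | t₂ ≤ t₁}`. -/
def simplex2 : Tope := .le t₂ t₁

/-- The face `0 ≡ t₂ ≤ t₁` of the 2-simplex. -/
def face01 : Tope := .and (.eq .zero t₂) (.le t₂ t₁)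

/-- The face `t₂ ≡ t₁` of the 2-simplex. -/
def face02 : Tope := .eq t₂ t₁

/-- The face `t₂ ≤ t₁ ≡ 1` of the 2-simplex. -/
def face12 : Tope := .and (.le t₂ t₁) (.eq t₁ .one)

/-- The boundary of the 2-simplex. -/
def bdry2 : Tope := .or face01 (.or face02 face12)

/-- The type `hom²_A(x, y, z, f, g, h)` of 2-simplices in `A` whose restriction to the boundary is
`f(t₁)` on `t₂ ≡ 0`, `h(t₁)` on `t₂ ≡ t₁` and `g(t₂)` on `t₁ ≡ 1` (the vertices being determined
by the arrows). -/
def hom2 (A f g h : Tm) : Tm :=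
  .ext (.prod .two .two) simplex2 A.wkCube bdry2
    (.recOr face01 (.or face02 face12) (.eapp f.wkCube t₁)
      (.recOr face02 face12 (.eapp h.wkCube t₁) (.eapp g.wkCube t₂)))

/-- `A` is a Segal type:
`Π (x y z : A) (f : hom_A(x, y)) (g : hom_A(y, z)),
  isContr (Σ (h : hom_A(x, z)), hom²_A(x, y, z, f, g, h))`. -/
def isSegal (A : Tm) : Tm :=
  .pi A <| .pi (A.wk 1) <| .pi (A.wk 2) <|
  .pi (hom (A.wk 3) (.var 2) (.var 1)) <| .pi (hom (A.wk 4) (.var 2) (.var 1)) <|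
  isContr (.sigma (hom (A.wk 5) (.var 4) (.var 2)) (hom2 (A.wk 6) (.var 2) (.var 1) (.var 0)))

/-- The dependent hom-type `hom_{C(f)}(u, v)` of a family `C : A → 𝒰` over an arrow `f` of `A`:
sections of `C(f(t))` over the 1-simplex restricting to `[u, v]` on the boundary. -/
def dhom (C f u v : Tm) : Tm :=
  .ext .two .top (.app C.wkCube (.eapp f.wkCube (.var 0))) bdry1 (endpoints u v)

/-- `C : A → 𝒰` is covariant:
`Π (x y : A) (f : hom_A(x, y)) (u : C(x)), isContr (Σ (v : C(y)), hom_{C(f)}(u, v))`. -/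
def isCovariant (A C : Tm) : Tm :=
  .pi A <| .pi (A.wk 1) <| .pi (hom (A.wk 2) (.var 1) (.var 0)) <|
  .pi (.app (C.wk 3) (.var 2)) <|
  isContr (.sigma (.app (C.wk 4) (.var 2)) (dhom (C.wk 5) (.var 2) (.var 1) (.var 0)))

/-- The transport `f_* u : C(y)` of `u : C(x)` along `f : hom_A(x, y)`, for `c` a witness that `C` is
covariant: the first component of the center of contraction of `Σ (v : C(y)), hom_{C(f)}(u, v)`. -/
def covTransport (c x y f u : Tm) : Tm := .fst (.fst (.app (.app (.app (.app c x) y) f) u))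

/-! ### The Yoneda maps -/

/-- `Π (x : A), (hom_A(a, x) → C(x))`. -/
def repMaps (A C a : Tm) : Tm :=
  .pi A (arrow (hom (A.wk 1) (a.wk 1) (.var 0)) (.app (C.wk 1) (.var 0)))

/-- `evid := λ φ, φ(a, id_a)`. -/
def evid (A C a : Tm) : Tm :=
  .lam (repMaps A C a) (.app (.app (.var 0) (a.wk 1)) (idArrow (a.wk 1)))

/-- `yon := λ u, λ x, λ f, f_* u`, for `c` a witness that `C` is covariant. -/
def yon (A C c a : Tm) : Tm :=
  .lam (.app C a) <| .lam (A.wk 1) <| .lam (hom (A.wk 2) (a.wk 2) (.var 0)) <|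
  covTransport (c.wk 3) (a.wk 3) (.var 1) (.var 0) (.var 2)

/-- For `f : X → Y` and `g : Y → X`, the type `Π (x : X), g(f(x)) = x`. -/
def retraction (X f g : Tm) : Tm :=
  .pi X (.id (X.wk 1) (.app (g.wk 1) (.app (f.wk 1) (.var 0))) (.var 0))

/-- For `f : X → Y`, the type `isequiv(f)` :=
`(Σ (g : Y → X), Π (y : Y), f(g(y)) = y) × (Σ (h : Y → X), Π (x : X), h(f(x)) = x)`. -/
def isEquiv (X Y f : Tm) : Tm :=
  .sigma (.sigma (arrow Y X) (retraction (Y.wk 1) (.var 0) (f.wk 1)))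
    (Tm.wk 1 (.sigma (arrow Y X) (retraction (X.wk 1) (f.wk 1) (.var 0))))

end STT

namespace STT

/-! ### Substitution calculus -/

@[simp] theorem scons_zero {α : Type} (x : α) (σ : ℕ → α) : scons x σ 0 = x := rfl

@[simp] theorem scons_succ {α : Type} (x : α) (σ : ℕ → α) (n : ℕ) : scons x σ (n + 1) = σ n := rfl

theorem CTm.subst_subst (κ κ' : ℕ → CTm) (t : CTm) :
    (t.subst κ).subst κ' = t.subst (fun n => (κ n).subst κ') := by
  induction t <;> simp_all [CTm.subst]

theorem CTm.subst_var (t : CTm) : t.subst CTm.var = t := by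
  induction t <;> simp_all [CTm.subst]

theorem Tope.subst_subst (κ κ' : ℕ → CTm) (φ : Tope) :
    (φ.subst κ).subst κ' = φ.subst (fun n => (κ n).subst κ') := by
  induction φ <;> simp_all [Tope.subst, CTm.subst_subst]

theorem Tope.subst_var (φ : Tope) : φ.subst CTm.var = φ := by
  induction φ <;> simp_all [Tope.subst, CTm.subst_var]

theorem upCube_ren (κ : ℕ → ℕ) :
    upCube (fun n => .var (κ n)) = fun n => .var (upRen κ n) := by
  funext n; cases n <;> rfl

theorem upTm_ren (ρ : ℕ → ℕ) : upTm (fun n => .var (ρ n)) = fun n => .var (upRen ρ n) := by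
  funext n; cases n <;> rfl

theorem Tm.ren_eq_subst (a : Tm) : ∀ (κ ρ : ℕ → ℕ),
    a.ren κ ρ = a.subst (fun n => .var (κ n)) (fun n => .var (ρ n)) := by
  induction a <;> intro κ ρ <;>
    simp_all [Tm.ren, Tm.subst, upCube_ren, upTm_ren, Tm.wkCube, CTm.ren, Tope.ren]

theorem upCube_comp_upRen (κ : ℕ → ℕ) (κ' : ℕ → CTm) :
    (fun n => upCube κ' (upRen κ n)) = upCube (fun n => κ' (κ n)) := by
  funext n; cases n <;> rfl

theorem upTm_comp_upRen (ρ : ℕ → ℕ) (σ : ℕ → Tm) :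
    (fun n => upTm σ (upRen ρ n)) = upTm (fun n => σ (ρ n)) := by
  funext n; cases n <;> rfl

theorem Tm.ren_subst (a : Tm) : ∀ (κ ρ : ℕ → ℕ) (κ' : ℕ → CTm) (σ : ℕ → Tm),
    (a.ren κ ρ).subst κ' σ = a.subst (fun n => κ' (κ n)) (fun n => σ (ρ n)) := by
  induction a <;> intro κ ρ κ' σ <;>
    simp_all [Tm.ren, Tm.subst, upCube_comp_upRen, upTm_comp_upRen, CTm.ren, Tope.ren,
      CTm.subst_subst, Tope.subst_subst, CTm.subst]

theorem Tm.ren_ren (a : Tm) (κ ρ κ' ρ' : ℕ → ℕ) :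
    (a.ren κ ρ).ren κ' ρ' = a.ren (fun n => κ' (κ n)) (fun n => ρ' (ρ n)) := by
  rw [Tm.ren_eq_subst _ κ' ρ', Tm.ren_subst, Tm.ren_eq_subst]

theorem upCube_ren_comp (κ : ℕ → CTm) (κ' : ℕ → ℕ) :
    (fun n => (upCube κ n).ren (upRen κ')) = upCube (fun n => (κ n).ren κ') := by
  funext n
  cases n with
  | zero => rfl
  | succ n => simp [upCube, CTm.ren, CTm.subst_subst, CTm.subst, upRen]

theorem upTm_ren_comp (σ : ℕ → Tm) (κ ρ : ℕ → ℕ) :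
    (fun n => (upTm σ n).ren κ (upRen ρ)) = upTm (fun n => (σ n).ren κ ρ) := by
  funext n
  cases n with
  | zero => rfl
  | succ n => simp [upTm, Tm.wk, Tm.ren_ren, upRen]

theorem wkCube_ren (σ : ℕ → Tm) (κ ρ : ℕ → ℕ) :
    (fun n => (σ n).wkCube.ren (upRen κ) ρ) = fun n => ((σ n).ren κ ρ).wkCube := by
  funext n
  simp [Tm.wkCube, Tm.ren_ren, upRen]

theorem Tm.subst_ren (a : Tm) : ∀ (κ : ℕ → CTm) (σ : ℕ → Tm) (κ' ρ : ℕ → ℕ),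
    (a.subst κ σ).ren κ' ρ = a.subst (fun n => (κ n).ren κ') (fun n => (σ n).ren κ' ρ) := by
  induction a <;> intro κ σ κ' ρ <;>
    simp_all [Tm.ren, Tm.subst, upCube_ren_comp, upTm_ren_comp, wkCube_ren]
  all_goals simp [CTm.ren, Tope.ren, CTm.subst_subst, Tope.subst_subst]

theorem upCube_subst (κ κ' : ℕ → CTm) :
    (fun n => (upCube κ n).subst (upCube κ')) = upCube (fun n => (κ n).subst κ') := by
  funext n
  cases n with
  | zero => rfl
  | succ n => simp [upCube, CTm.ren, CTm.subst_subst, CTm.subst]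

theorem upTm_subst (σ σ' : ℕ → Tm) (κ : ℕ → CTm) :
    (fun n => (upTm σ n).subst κ (upTm σ')) = upTm (fun n => (σ n).subst κ σ') := by
  funext n
  cases n with
  | zero => rfl
  | succ n =>
    simp only [upTm, scons_succ, Tm.wk, Tm.ren_subst, Tm.subst_ren]
    simp [CTm.ren, CTm.subst_var]

theorem wkCube_subst (σ σ' : ℕ → Tm) (κ : ℕ → CTm) :
    (fun n => (σ n).wkCube.subst (upCube κ) (fun k => (σ' k).wkCube)) =
      fun n => ((σ n).subst κ σ').wkCube := by
  funext n
  simp [Tm.wkCube, Tm.ren_subst, Tm.subst_ren, upCube]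

theorem Tm.subst_subst (a : Tm) : ∀ (κ : ℕ → CTm) (σ : ℕ → Tm) (κ' : ℕ → CTm) (σ' : ℕ → Tm),
    (a.subst κ σ).subst κ' σ' =
      a.subst (fun n => (κ n).subst κ') (fun n => (σ n).subst κ' σ') := by
  induction a <;> intro κ σ κ' σ' <;>
    simp_all [Tm.subst, upCube_subst, upTm_subst, wkCube_subst, CTm.subst_subst,
      Tope.subst_subst]

theorem upCube_var : upCube CTm.var = CTm.var := by
  funext n; cases n <;> rfl

theorem upTm_var : upTm Tm.var = Tm.var := by
  funext n; cases n <;> rfl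

theorem Tm.subst_var (a : Tm) : a.subst CTm.var Tm.var = a := by
  induction a <;>
    simp_all [Tm.subst, upCube_var, upTm_var, Tm.wkCube, Tm.ren, CTm.subst_var, Tope.subst_var]

theorem Tm.wk_eq (a : Tm) (n : ℕ) :
    a.wk n = a.subst CTm.var (fun k => .var (k + n)) := by
  rw [Tm.wk, Tm.ren_eq_subst]

theorem Tm.wkCube_eq (a : Tm) :
    a.wkCube = a.subst (fun k => .var (k + 1)) Tm.var := by
  rw [Tm.wkCube, Tm.ren_eq_subst]

attribute [simp] Tm.subst_subst Tm.subst_var Tm.wk_eq Tm.wkCube_eq CTm.subst_subst CTm.subst_var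
  Tope.subst_subst Tope.subst_var Tm.subst CTm.subst Tope.subst Tm.inst Tm.inst₂ Tm.cinst
  CTm.ren Tope.ren instCube upCube upTm

/-! ### Structural rules -/

theorem CubeHas.subst {Ξ Ξ' : List Cube} {κ : ℕ → CTm} {t : CTm} {I : Cube}
    (hκ : ∀ n J, Ξ[n]? = some J → CubeHas Ξ' (κ n) J) (h : CubeHas Ξ t I) :
    CubeHas Ξ' (t.subst κ) I := by
  induction h with
  | var h => exact hκ _ _ h
  | star => exact .star
  | pair _ _ ih₁ ih₂ => exact .pair ih₁ ih₂
  | fst _ ih => exact .fst ih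
  | snd _ ih => exact .snd ih
  | zero => exact .zero
  | one => exact .one

theorem TopeWf.subst {Ξ Ξ' : List Cube} {κ : ℕ → CTm} {φ : Tope}
    (hκ : ∀ n J, Ξ[n]? = some J → CubeHas Ξ' (κ n) J) (h : TopeWf Ξ φ) :
    TopeWf Ξ' (φ.subst κ) := by
  induction h with
  | top => exact .top
  | bot => exact .bot
  | and _ _ ih₁ ih₂ => exact .and ih₁ ih₂
  | or _ _ ih₁ ih₂ => exact .or ih₁ ih₂
  | eq h₁ h₂ => exact .eq (h₁.subst hκ) (h₂.subst hκ)
  | le h₁ h₂ => exact .le (h₁.subst hκ) (h₂.subst hκ)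

theorem CubeHas.wk {Ξ : List Cube} {t : CTm} {I J : Cube} (h : CubeHas Ξ t I) :
    CubeHas (J :: Ξ) (t.ren Nat.succ) I :=
  h.subst fun _ _ hn => .var hn

theorem TopeWf.wk {Ξ : List Cube} {φ : Tope} {J : Cube} (h : TopeWf Ξ φ) :
    TopeWf (J :: Ξ) (φ.ren Nat.succ) :=
  h.subst fun _ _ hn => .var hn

theorem Ctx.topeWf {Ξ : List Cube} {Φ : List Tope} {Γ : List Tm} (h : Ctx Ξ Φ Γ) :
    ∀ φ ∈ Φ, TopeWf Ξ φ := by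
  induction Γ with
  | nil => cases h; assumption
  | cons A Γ ih => cases h; exact ih ‹_›

section

variable {Ξ : List Cube} {Φ Φ' : List Tope} {Γ : List Tm} {I : Cube} {a b A B : Tm} {φ ψ : Tope}

theorem JEq.left {Ξ Φ Γ a b A} (h : JEq Ξ Φ Γ a b A) : JEq Ξ Φ Γ a a A := h.trans h.symm

theorem JEq.right {Ξ Φ Γ a b A} (h : JEq Ξ Φ Γ a b A) : JEq Ξ Φ Γ b b A := h.symm.trans h

theorem JEq.var_zero (hB : Ctx Ξ Φ (B :: Γ)) : JEq Ξ Φ (B :: Γ) (.var 0) (.var 0) (B.wk 1) :=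
  .var hB rfl

theorem JEq.wk (hB : Ctx Ξ Φ (B :: Γ)) (h : JEq Ξ Φ Γ a b A) :
    JEq Ξ Φ (B :: Γ) (a.wk 1) (b.wk 1) (A.wk 1) := by
  simp only [Tm.wk_eq]
  refine .subst hB (fun n J hn => .var hn) (fun φ hφ => by simpa using .hyp hφ) ?_ h
  intro n D hn
  have := JEq.var (n := n + 1) (A := D) hB (by simpa using hn)
  simpa [add_assoc, add_comm, add_left_comm] using this

theorem JEq.mono (hΓ : Ctx Ξ Φ' Γ) (hΦ : ∀ φ ∈ Φ, Entails Ξ Φ' φ) (h : JEq Ξ Φ Γ a b A) :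
    JEq Ξ Φ' Γ a b A := by
  have := JEq.subst (κ := CTm.var) (σ := Tm.var) hΓ (fun n J hn => .var hn)
    (fun φ hφ => by simpa using hΦ φ hφ) (fun n D hn => by simpa using JEq.var hΓ hn) h
  simpa using this

theorem Ctx.mono (hΓ : Ctx Ξ Φ Γ) (hwf : ∀ φ ∈ Φ', TopeWf Ξ φ)
    (hΦ : ∀ φ ∈ Φ, Entails Ξ Φ' φ) : Ctx Ξ Φ' Γ := by
  induction Γ with
  | nil => exact .nil hwf
  | cons A Γ ih =>
    cases hΓ with
    | cons h hA => exact .cons (ih h) (hA.mono (ih h) hΦ)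

theorem Ctx.tope (hΓ : Ctx Ξ Φ Γ) (hφ : TopeWf Ξ φ) : Ctx Ξ (φ :: Φ) Γ :=
  hΓ.mono (by simpa using ⟨hφ, hΓ.topeWf⟩) fun ψ hψ => .hyp (by simp [hψ])

theorem JEq.tope (hΓ : Ctx Ξ Φ Γ) (hφ : TopeWf Ξ φ) (h : JEq Ξ Φ Γ a b A) :
    JEq Ξ (φ :: Φ) Γ a b A :=
  h.mono (hΓ.tope hφ) fun ψ hψ => .hyp (by simp [hψ])

theorem JEq.cut (hΓ : Ctx Ξ Φ Γ) (hφ : Entails Ξ Φ φ) (h : JEq Ξ (φ :: Φ) Γ a b A) :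
    JEq Ξ Φ Γ a b A :=
  h.mono hΓ fun ψ hψ => by
    rcases List.mem_cons.1 hψ with rfl | hψ
    · exact hφ
    · exact .hyp hψ

theorem JEq.wkCube (hΓ : Ctx (I :: Ξ) Φ' (wkCtx Γ))
    (hΦ : ∀ φ ∈ Φ, Entails (I :: Ξ) Φ' (φ.ren Nat.succ)) (h : JEq Ξ Φ Γ a b A) :
    JEq (I :: Ξ) Φ' (wkCtx Γ) a.wkCube b.wkCube A.wkCube := by
  simp only [Tm.wkCube_eq]
  refine .subst hΓ (fun n J hn => .var hn) hΦ ?_ h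
  intro n D hn
  have := JEq.var (n := n) (A := D.wkCube) hΓ (by simp only [wkCtx, List.getElem?_map, hn]; rfl)
  simpa using this

theorem Ctx.wkCube (hΓ : Ctx Ξ Φ Γ) (hwf : ∀ φ ∈ Φ', TopeWf (I :: Ξ) φ)
    (hΦ : ∀ φ ∈ Φ, Entails (I :: Ξ) Φ' (φ.ren Nat.succ)) : Ctx (I :: Ξ) Φ' (wkCtx Γ) := by
  induction Γ with
  | nil => exact .nil hwf
  | cons A Γ ih =>
    cases hΓ with
    | cons h hA => exact .cons (ih h) (hA.wkCube (ih h) hΦ)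

theorem Ctx.ext (hΓ : Ctx Ξ Φ Γ) (hψ : TopeWf (I :: Ξ) ψ) :
    Ctx (I :: Ξ) (extTopes Φ ψ) (wkCtx Γ) :=
  hΓ.wkCube (by
    simp only [extTopes, List.mem_cons, List.mem_map]
    rintro φ (rfl | ⟨χ, hχ, rfl⟩)
    · exact hψ
    · exact (hΓ.topeWf χ hχ).wk)
    fun _ hφ => .hyp (List.mem_cons_of_mem _ (List.mem_map_of_mem hφ))

theorem JEq.wkExt (hΓ : Ctx Ξ Φ Γ) (hψ : TopeWf (I :: Ξ) ψ) (h : JEq Ξ Φ Γ a b A) :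
    JEq (I :: Ξ) (extTopes Φ ψ) (wkCtx Γ) a.wkCube b.wkCube A.wkCube :=
  h.wkCube (hΓ.ext hψ) fun _ hφ => .hyp (List.mem_cons_of_mem _ (List.mem_map_of_mem hφ))

/-- Instantiating the newest cube variable. -/
theorem JEq.instExt {s : CTm} (hΓ : Ctx Ξ Φ Γ) (hs : CubeHas Ξ s I)
    (hψ : Entails Ξ Φ (ψ.subst (instCube s)))
    (h : JEq (I :: Ξ) (extTopes Φ ψ) (wkCtx Γ) a b A) :
    JEq Ξ Φ Γ (a.cinst s) (b.cinst s) (A.cinst s) := by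
  refine .subst hΓ ?_ ?_ ?_ h
  · rintro (_ | n) J hn
    · obtain rfl : I = J := by simpa using hn
      exact hs
    · exact .var hn
  · simp only [extTopes, List.mem_cons, List.mem_map]
    rintro φ (rfl | ⟨χ, hχ, rfl⟩)
    · exact hψ
    · simpa using .hyp hχ
  · intro n D hn
    simp only [wkCtx, List.getElem?_map, Option.map_eq_some_iff] at hn
    obtain ⟨D, hD, rfl⟩ := hn
    simpa using JEq.var hΓ hD

theorem JEq.orElim {i : ℕ} (hΓ : Ctx Ξ Φ Γ) (hφ : TopeWf Ξ φ) (hψ : TopeWf Ξ ψ)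
    (h : Entails Ξ Φ (.or φ ψ)) (hA : JEq Ξ Φ Γ A A (.univ i)) (ha : JEq Ξ Φ Γ a a A)
    (hb : JEq Ξ Φ Γ b b A) (h₁ : JEq Ξ (φ :: Φ) Γ a b A) (h₂ : JEq Ξ (ψ :: Φ) Γ a b A) :
    JEq Ξ Φ Γ a b A :=
  (JEq.recOrEta h ha).trans <|
    (JEq.recOr h hA h₁ h₂ (ha.tope hΓ (.and hφ hψ))).trans (JEq.recOrEta h hb).symm

theorem JEq.botElim (h : Entails Ξ Φ .bot) (ha : JEq Ξ Φ Γ a a A) (hb : JEq Ξ Φ Γ b b A) :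
    JEq Ξ Φ Γ a b A :=
  (JEq.recBotEta h ha).trans (JEq.recBotEta h hb).symm

theorem JEq.eapp_eq {f : Tm} {s t : CTm} (hΓ : Ctx Ξ Φ Γ)
    (hf : JEq Ξ Φ Γ f f (.ext I .top A φ a)) (hs : CubeHas Ξ s I) (ht : CubeHas Ξ t I)
    (hst : Entails Ξ Φ (.eq s t)) : JEq Ξ Φ Γ (.eapp f s) (.eapp f t) (A.cinst s) := by
  have hΓ' : Ctx (I :: Ξ) (Φ.map (Tope.ren Nat.succ)) (wkCtx Γ) := by
    refine hΓ.wkCube ?_ fun _ hφ => .hyp (List.mem_map_of_mem hφ)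
    simp only [List.mem_map]
    rintro φ ⟨χ, hχ, rfl⟩
    exact (hΓ.topeWf χ hχ).wk
  have hf' := hf.wkCube hΓ' fun φ hφ => .hyp (List.mem_map_of_mem hφ)
  have := JEq.topeEq hs ht hst (JEq.eapp hf' (.var (n := 0) rfl) .topI)
  have e : (wkCtx Γ).map (fun B => B.cinst s) = Γ := by
    simp [wkCtx, Function.comp_def]
  rw [e] at this
  convert this using 1 <;> simp [Tm.ren_eq_subst]
  congr 1; funext n; cases n <;> simp [upRen]

end

/-! ### Sections over the 1-simplex with prescribed endpoints -/

/-- The tope `0 ≡ t`. -/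
def atZero : Tope := .eq .zero (.var 0)

/-- The tope `t ≡ 1`. -/
def atOne : Tope := .eq (.var 0) .one

/-- The type of sections of `B` over the 1-simplex from `u` to `v`. -/
def sect (B u v : Tm) : Tm := .ext .two .top B bdry1 (endpoints u v)

theorem atZero_wf {Ξ : List Cube} : TopeWf (.two :: Ξ) atZero := .eq .zero (.var rfl)

theorem atOne_wf {Ξ : List Cube} : TopeWf (.two :: Ξ) atOne := .eq (.var rfl) .one

theorem bdry1_wf {Ξ : List Cube} : TopeWf (.two :: Ξ) bdry1 := .or atZero_wf atOne_wf

theorem mem_extTopes_head {Φ : List Tope} {ψ : Tope} : ψ ∈ extTopes Φ ψ :=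
  List.mem_cons_self

/-- `u ≡ u'` and `v ≡ v'` are endpoints of sections of `B`. -/
structure SectEq (Ξ : List Cube) (Φ : List Tope) (Γ : List Tm) (B u u' v v' : Tm) (i : ℕ) :
    Prop where
  ctx : Ctx Ξ Φ Γ
  fam : JEq (.two :: Ξ) (extTopes Φ .top) (wkCtx Γ) B B (.univ i)
  src : JEq (.two :: Ξ) (extTopes Φ atZero) (wkCtx Γ) u.wkCube u'.wkCube B
  tgt : JEq (.two :: Ξ) (extTopes Φ atOne) (wkCtx Γ) v.wkCube v'.wkCube B

section

variable {Ξ : List Cube} {Φ : List Tope} {Γ : List Tm} {a b b' A B C u u' v v' : Tm} {i : ℕ}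

theorem JEq.extMono {I : Cube} {φ ψ χ : Tope} (hΓ : Ctx Ξ Φ Γ) (hφ : TopeWf (I :: Ξ) φ)
    (hχ : TopeWf (I :: Ξ) χ) (h : Entails (I :: Ξ) (χ :: extTopes Φ φ) ψ)
    (ha : JEq (I :: Ξ) (extTopes Φ ψ) (wkCtx Γ) a b A) :
    JEq (I :: Ξ) (χ :: extTopes Φ φ) (wkCtx Γ) a b A := by
  refine ha.mono ((hΓ.ext hφ).tope hχ) fun θ hθ => ?_
  rcases List.mem_cons.1 hθ with rfl | hθ
  · exact h
  · exact .hyp (List.mem_cons_of_mem _ (List.mem_cons_of_mem _ hθ))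

theorem JEq.ofTop {I : Cube} {φ : Tope} (hΓ : Ctx Ξ Φ Γ) (hφ : TopeWf (I :: Ξ) φ)
    (ha : JEq (I :: Ξ) (extTopes Φ .top) (wkCtx Γ) a b A) :
    JEq (I :: Ξ) (extTopes Φ φ) (wkCtx Γ) a b A := by
  refine ha.mono (hΓ.ext hφ) fun θ hθ => ?_
  rcases List.mem_cons.1 hθ with rfl | hθ
  · exact .topI
  · exact .hyp (List.mem_cons_of_mem _ hθ)

theorem entails_bot_of_endpoints {Ξ : List Cube} {Φ : List Tope} {s : CTm}
    (h₀ : Entails Ξ Φ (.eq .zero s)) (h₁ : Entails Ξ Φ (.eq s .one)) : Entails Ξ Φ .bot :=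
  .zeroNeOne (.eqTrans h₀ h₁)

theorem SectEq.overlap (h : SectEq Ξ Φ Γ B u u' v v' i) :
    JEq (.two :: Ξ) (.and atZero atOne :: extTopes Φ bdry1) (wkCtx Γ) u.wkCube v.wkCube B := by
  have hh : Entails (.two :: Ξ) (.and atZero atOne :: extTopes Φ bdry1) (.and atZero atOne) :=
    .hyp List.mem_cons_self
  have hwf := TopeWf.and (atZero_wf (Ξ := Ξ)) atOne_wf
  exact .botElim (entails_bot_of_endpoints (.andE₁ hh) (.andE₂ hh))
    (h.src.left.extMono h.ctx bdry1_wf hwf (.andE₁ hh))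
    (h.tgt.left.extMono h.ctx bdry1_wf hwf (.andE₂ hh))

theorem SectEq.endpoints_congr (h : SectEq Ξ Φ Γ B u u' v v' i) :
    JEq (.two :: Ξ) (extTopes Φ bdry1) (wkCtx Γ) (endpoints u v) (endpoints u' v') B :=
  .recOr (.hyp mem_extTopes_head) (h.fam.ofTop h.ctx bdry1_wf)
    (h.src.extMono h.ctx bdry1_wf atZero_wf (.hyp List.mem_cons_self))
    (h.tgt.extMono h.ctx bdry1_wf atOne_wf (.hyp List.mem_cons_self)) h.overlap

theorem SectEq.form (h : SectEq Ξ Φ Γ B u u' v v' i) :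
    JEq Ξ Φ Γ (sect B u v) (sect B u' v') (.univ i) :=
  .ext bdry1_wf .top .topI h.ctx h.fam h.endpoints_congr

theorem SectEq.elam_congr (h : SectEq Ξ Φ Γ B u u v v i)
    (hb : JEq (.two :: Ξ) (extTopes Φ .top) (wkCtx Γ) b b' B)
    (h₀ : JEq (.two :: Ξ) (extTopes Φ atZero) (wkCtx Γ) b u.wkCube B)
    (h₁ : JEq (.two :: Ξ) (extTopes Φ atOne) (wkCtx Γ) b v.wkCube B) :
    JEq Ξ Φ Γ (.elam .two .top b) (.elam .two .top b') (sect B u v) := by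
  refine .elam bdry1_wf .top .topI h.ctx h.fam h.endpoints_congr hb ?_
  refine .orElim (h.ctx.ext bdry1_wf) atZero_wf atOne_wf (.hyp mem_extTopes_head)
    (h.fam.ofTop h.ctx bdry1_wf) (hb.left.ofTop h.ctx bdry1_wf) h.endpoints_congr ?_ ?_
  · exact (h₀.extMono h.ctx bdry1_wf atZero_wf (.hyp List.mem_cons_self)).trans
      (.symm (.recOrBeta₁ (.hyp mem_extTopes_head) (h.fam.ofTop h.ctx bdry1_wf)
        (h.src.extMono h.ctx bdry1_wf atZero_wf (.hyp List.mem_cons_self))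
        (h.tgt.extMono h.ctx bdry1_wf atOne_wf (.hyp List.mem_cons_self)) h.overlap))
  · exact (h₁.extMono h.ctx bdry1_wf atOne_wf (.hyp List.mem_cons_self)).trans
      (.symm (.recOrBeta₂ (.hyp mem_extTopes_head) (h.fam.ofTop h.ctx bdry1_wf)
        (h.src.extMono h.ctx bdry1_wf atZero_wf (.hyp List.mem_cons_self))
        (h.tgt.extMono h.ctx bdry1_wf atOne_wf (.hyp List.mem_cons_self)) h.overlap))

theorem JEq.eappSect {f f' : Tm} {s : CTm} (hs : CubeHas Ξ s .two)
    (hf : JEq Ξ Φ Γ f f' (sect B u v)) : JEq Ξ Φ Γ (.eapp f s) (.eapp f' s) (B.cinst s) :=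
  .eapp hf hs .topI

theorem SectEq.beta {s : CTm} (h : SectEq Ξ Φ Γ B u u v v i)
    (hb : JEq (.two :: Ξ) (extTopes Φ .top) (wkCtx Γ) b b B)
    (hs : CubeHas Ξ s .two) :
    JEq Ξ Φ Γ (.eapp (.elam .two .top b) s) (b.cinst s) (B.cinst s) := by
  refine .extBeta (φ := .bot) (a := .recBot) .bot .top .topI h.ctx h.fam ?_ hb ?_ hs .topI
  · exact .recBot (.hyp mem_extTopes_head) (h.fam.ofTop h.ctx .bot)
  · exact .recBotEta (.hyp mem_extTopes_head) (hb.ofTop h.ctx .bot)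

theorem wkCube_cinst (a : Tm) (s : CTm) : a.wkCube.cinst s = a := by simp

theorem SectEq.eapp_zero {f : Tm} {s : CTm} (h : SectEq Ξ Φ Γ B u u v v i)
    (hf : JEq Ξ Φ Γ f f (sect B u v)) (hs : CubeHas Ξ s .two)
    (h₀ : Entails Ξ Φ (.eq .zero s)) : JEq Ξ Φ Γ (.eapp f s) u (B.cinst s) := by
  have hB := JEq.extBoundary hf hs (.orI₁ (.eq hs .one) h₀)
  have := ((h.endpoints_congr.mono (Φ' := atZero :: extTopes Φ bdry1)
    ((h.ctx.ext bdry1_wf).tope atZero_wf) fun θ hθ => .hyp (List.mem_cons_of_mem _ hθ)).symm.trans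
      (JEq.recOrBeta₁ (φ := atZero) (ψ := atOne) (.hyp mem_extTopes_head)
        (h.fam.ofTop h.ctx bdry1_wf)
        (h.src.extMono h.ctx bdry1_wf atZero_wf (.hyp List.mem_cons_self))
        (h.tgt.extMono h.ctx bdry1_wf atOne_wf (.hyp List.mem_cons_self)) h.overlap))
  have := (this.mono (Φ' := extTopes Φ atZero) (h.ctx.ext atZero_wf) (by
    intro θ hθ
    rcases List.mem_cons.1 hθ with rfl | hθ
    · exact .hyp mem_extTopes_head
    rcases List.mem_cons.1 hθ with rfl | hθ
    · exact .orI₁ atOne_wf (.hyp mem_extTopes_head)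
    · exact .hyp (List.mem_cons_of_mem _ hθ))).instExt (ψ := atZero) h.ctx hs h₀
  rw [wkCube_cinst] at this
  exact hB.trans this

theorem SectEq.eapp_one {f : Tm} {s : CTm} (h : SectEq Ξ Φ Γ B u u v v i)
    (hf : JEq Ξ Φ Γ f f (sect B u v)) (hs : CubeHas Ξ s .two)
    (h₁ : Entails Ξ Φ (.eq s .one)) : JEq Ξ Φ Γ (.eapp f s) v (B.cinst s) := by
  have hB := JEq.extBoundary hf hs (.orI₂ (.eq .zero hs) h₁)
  have := ((h.endpoints_congr.mono (Φ' := atOne :: extTopes Φ bdry1)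
    ((h.ctx.ext bdry1_wf).tope atOne_wf) fun θ hθ => .hyp (List.mem_cons_of_mem _ hθ)).symm.trans
      (JEq.recOrBeta₂ (φ := atZero) (ψ := atOne) (.hyp mem_extTopes_head)
        (h.fam.ofTop h.ctx bdry1_wf)
        (h.src.extMono h.ctx bdry1_wf atZero_wf (.hyp List.mem_cons_self))
        (h.tgt.extMono h.ctx bdry1_wf atOne_wf (.hyp List.mem_cons_self)) h.overlap))
  have := (this.mono (Φ' := extTopes Φ atOne) (h.ctx.ext atOne_wf) (by
    intro θ hθ
    rcases List.mem_cons.1 hθ with rfl | hθ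
    · exact .hyp mem_extTopes_head
    rcases List.mem_cons.1 hθ with rfl | hθ
    · exact .orI₂ atZero_wf (.hyp mem_extTopes_head)
    · exact .hyp (List.mem_cons_of_mem _ hθ))).instExt (ψ := atOne) h.ctx hs h₁
  rw [wkCube_cinst] at this
  exact hB.trans this

/-! ### Arrows -/

theorem SectEq.ofHom {x x' y y' : Tm} (hΓ : Ctx Ξ Φ Γ) (hA : JEq Ξ Φ Γ A A (.univ i))
    (hx : JEq Ξ Φ Γ x x' A) (hy : JEq Ξ Φ Γ y y' A) :
    SectEq Ξ Φ Γ A.wkCube x x' y y' i :=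
  ⟨hΓ, hA.wkExt hΓ .top, hx.wkExt hΓ atZero_wf, hy.wkExt hΓ atOne_wf⟩

theorem JEq.hom_congr {x x' y y' : Tm} (hΓ : Ctx Ξ Φ Γ) (hA : JEq Ξ Φ Γ A A (.univ i))
    (hx : JEq Ξ Φ Γ x x' A) (hy : JEq Ξ Φ Γ y y' A) :
    JEq Ξ Φ Γ (hom A x y) (hom A x' y') (.univ i) :=
  (SectEq.ofHom hΓ hA hx hy).form

theorem JEq.eappHom {f f' x y : Tm} {s : CTm} (hf : JEq Ξ Φ Γ f f' (hom A x y))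
    (hs : CubeHas Ξ s .two) : JEq Ξ Φ Γ (.eapp f s) (.eapp f' s) A := by
  simpa using JEq.eappSect hs hf

theorem JEq.eappHom_eq {f x y : Tm} {s t : CTm} (hΓ : Ctx Ξ Φ Γ)
    (hf : JEq Ξ Φ Γ f f (hom A x y)) (hs : CubeHas Ξ s .two) (ht : CubeHas Ξ t .two)
    (h : Entails Ξ Φ (.eq s t)) : JEq Ξ Φ Γ (.eapp f s) (.eapp f t) A := by
  simpa using JEq.eapp_eq hΓ hf hs ht h

theorem JEq.eappHom_zero {f x y : Tm} {s : CTm} (hf : JEq Ξ Φ Γ f f (hom A x y))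
    (hΓ : Ctx Ξ Φ Γ) (hA : JEq Ξ Φ Γ A A (.univ i)) (hx : JEq Ξ Φ Γ x x A)
    (hy : JEq Ξ Φ Γ y y A) (hs : CubeHas Ξ s .two)
    (h : Entails Ξ Φ (.eq .zero s)) : JEq Ξ Φ Γ (.eapp f s) x A := by
  simpa using (SectEq.ofHom hΓ hA hx hy).eapp_zero hf hs h

theorem JEq.eappHom_one {f x y : Tm} {s : CTm} (hf : JEq Ξ Φ Γ f f (hom A x y))
    (hΓ : Ctx Ξ Φ Γ) (hA : JEq Ξ Φ Γ A A (.univ i)) (hx : JEq Ξ Φ Γ x x A)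
    (hy : JEq Ξ Φ Γ y y A) (hs : CubeHas Ξ s .two)
    (h : Entails Ξ Φ (.eq s .one)) : JEq Ξ Φ Γ (.eapp f s) y A := by
  simpa using (SectEq.ofHom hΓ hA hx hy).eapp_one hf hs h

theorem JEq.idArrow_congr {x x' : Tm} (hΓ : Ctx Ξ Φ Γ) (hA : JEq Ξ Φ Γ A A (.univ i))
    (hx : JEq Ξ Φ Γ x x' A) :
    JEq Ξ Φ Γ (idArrow x) (idArrow x') (hom A x x) :=
  (SectEq.ofHom hΓ hA hx.left hx.left).elam_congr (hx.wkExt hΓ .top) (hx.left.wkExt hΓ atZero_wf)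
    (hx.left.wkExt hΓ atOne_wf)

end

/-! ### Substitution in derived types -/

@[simp] theorem hom_subst (A x y : Tm) (κ : ℕ → CTm) (σ : ℕ → Tm) :
    (hom A x y).subst κ σ = hom (A.subst κ σ) (x.subst κ σ) (y.subst κ σ) := by
  simp [hom, endpoints]

@[simp] theorem dhom_subst (C f u v : Tm) (κ : ℕ → CTm) (σ : ℕ → Tm) :
    (dhom C f u v).subst κ σ =
      dhom (C.subst κ σ) (f.subst κ σ) (u.subst κ σ) (v.subst κ σ) := by
  simp [dhom, endpoints]

@[simp] theorem idArrow_subst (x : Tm) (κ : ℕ → CTm) (σ : ℕ → Tm) :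
    (idArrow x).subst κ σ = idArrow (x.subst κ σ) := by
  simp [idArrow]

@[simp] theorem arrow_subst (A B : Tm) (κ : ℕ → CTm) (σ : ℕ → Tm) :
    (arrow A B).subst κ σ = arrow (A.subst κ σ) (B.subst κ σ) := by
  simp [arrow]

@[simp] theorem isContr_subst (A : Tm) (κ : ℕ → CTm) (σ : ℕ → Tm) :
    (isContr A).subst κ σ = isContr (A.subst κ σ) := by
  simp [isContr]

@[simp] theorem isCovariant_subst (A C : Tm) (κ : ℕ → CTm) (σ : ℕ → Tm) :
    (isCovariant A C).subst κ σ = isCovariant (A.subst κ σ) (C.subst κ σ) := by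
  simp [isCovariant]

@[simp] theorem covTransport_subst (c x y f u : Tm) (κ : ℕ → CTm) (σ : ℕ → Tm) :
    (covTransport c x y f u).subst κ σ = covTransport (c.subst κ σ) (x.subst κ σ)
      (y.subst κ σ) (f.subst κ σ) (u.subst κ σ) := rfl

@[simp] theorem repMaps_subst (A C a : Tm) (κ : ℕ → CTm) (σ : ℕ → Tm) :
    (repMaps A C a).subst κ σ = repMaps (A.subst κ σ) (C.subst κ σ) (a.subst κ σ) := by
  simp [repMaps]

@[simp] theorem evid_subst (A C a : Tm) (κ : ℕ → CTm) (σ : ℕ → Tm) :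
    (evid A C a).subst κ σ = evid (A.subst κ σ) (C.subst κ σ) (a.subst κ σ) := by
  simp [evid]

@[simp] theorem yon_subst (A C c a : Tm) (κ : ℕ → CTm) (σ : ℕ → Tm) :
    (yon A C c a).subst κ σ =
      yon (A.subst κ σ) (C.subst κ σ) (c.subst κ σ) (a.subst κ σ) := by
  simp [yon]

/-! ### The connection square of an arrow -/

theorem Entails.le_of_eq {Ξ : List Cube} {Φ : List Tope} {s t : CTm} (hs : CubeHas Ξ s .two)
    (ht : CubeHas Ξ t .two) (h : Entails Ξ Φ (.eq s t)) : Entails Ξ Φ (.le s t) := by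
  have := Entails.eqSubst (ψ := .le (s.ren Nat.succ) (.var 0)) hs ht h
    (.le hs.wk (.var rfl)) (by simpa using .leRefl hs)
  simpa using this

theorem Entails.subst {Ξ Ξ' : List Cube} {Φ Φ' : List Tope} {κ : ℕ → CTm} {φ : Tope}
    (hκ : ∀ n J, Ξ[n]? = some J → CubeHas Ξ' (κ n) J) (hΦ : ∀ φ ∈ Φ, φ.subst κ ∈ Φ')
    (h : Entails Ξ Φ φ) : Entails Ξ' Φ' (φ.subst κ) := by
  induction h generalizing Φ' with
  | hyp h => exact .hyp (hΦ _ h)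
  | topI => exact .topI
  | botE hψ _ ih => exact .botE (hψ.subst hκ) (ih hΦ)
  | andI _ _ ih₁ ih₂ => exact .andI (ih₁ hΦ) (ih₂ hΦ)
  | andE₁ _ ih => exact .andE₁ (ih hΦ)
  | andE₂ _ ih => exact .andE₂ (ih hΦ)
  | orI₁ hψ _ ih => exact .orI₁ (hψ.subst hκ) (ih hΦ)
  | orI₂ hφ _ ih => exact .orI₂ (hφ.subst hκ) (ih hΦ)
  | orE _ _ _ ih₁ ih₂ ih₃ =>
    refine .orE (ih₁ fun θ hθ => ?_) (ih₂ fun θ hθ => ?_) (ih₃ hΦ) <;>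
      rcases List.mem_cons.1 hθ with rfl | hθ
    · exact List.mem_cons_self
    · exact List.mem_cons_of_mem _ (hΦ _ hθ)
    · exact List.mem_cons_self
    · exact List.mem_cons_of_mem _ (hΦ _ hθ)
  | eqRefl hs => exact .eqRefl (hs.subst hκ)
  | eqSymm _ ih => exact .eqSymm (ih hΦ)
  | eqTrans _ _ ih₁ ih₂ => exact .eqTrans (ih₁ hΦ) (ih₂ hΦ)
  | @eqSubst _ s t I ψ hs ht _ hψ _ ih₁ ih₂ =>
    have e (s : CTm) : (ψ.subst (instCube s)).subst κ =
        (ψ.subst (upCube κ)).subst (instCube (s.subst κ)) := by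
      simp only [Tope.subst_subst]
      congr 1; funext n; cases n <;> simp
    rw [e]
    refine .eqSubst (hs.subst hκ) (ht.subst hκ) (ih₁ hΦ) (hψ.subst ?_) (e s ▸ ih₂ hΦ)
    rintro (_ | n) J hn
    · exact .var hn
    · exact (hκ n J hn).wk
  | starEta ht => exact .starEta (ht.subst hκ)
  | fstBeta hs ht => exact .fstBeta (hs.subst hκ) (ht.subst hκ)
  | sndBeta hs ht => exact .sndBeta (hs.subst hκ) (ht.subst hκ)
  | pairEta ht => exact .pairEta (ht.subst hκ)
  | leRefl h => exact .leRefl (h.subst hκ)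
  | leTrans _ _ ih₁ ih₂ => exact .leTrans (ih₁ hΦ) (ih₂ hΦ)
  | leAntisymm _ _ ih₁ ih₂ => exact .leAntisymm (ih₁ hΦ) (ih₂ hΦ)
  | leTotal hx hy => exact .leTotal (hx.subst hκ) (hy.subst hκ)
  | zeroLe h => exact .zeroLe (h.subst hκ)
  | leOne h => exact .leOne (h.subst hκ)
  | zeroNeOne _ ih => exact .zeroNeOne (ih hΦ)

theorem Entails.wkExt {Ξ : List Cube} {Φ : List Tope} {I : Cube} {ψ φ : Tope}
    (h : Entails Ξ Φ φ) : Entails (I :: Ξ) (extTopes Φ ψ) (φ.ren Nat.succ) :=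
  h.subst (fun _ _ hn => .var hn) fun _ hφ => List.mem_cons_of_mem _ (List.mem_map_of_mem hφ)

/-- The value of an arrow `f` at the minimum of `s` and `r`. -/
def eappMin (f : Tm) (s r : CTm) : Tm := .recOr (.le s r) (.le r s) (.eapp f s) (.eapp f r)

/-- The arrow `s ↦ f(min(s, r))`. -/
def conn (f : Tm) (r : CTm) : Tm :=
  .elam .two .top (eappMin f.wkCube (.var 0) (r.ren Nat.succ))

theorem idArrow_wkCube (x : Tm) : (idArrow x).wkCube = idArrow x.wkCube := by simp

theorem hom_wkCube (A x y : Tm) :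
    (hom A x y).wkCube = hom A.wkCube x.wkCube y.wkCube := by simp

section

variable {Ξ : List Cube} {Φ : List Tope} {Γ : List Tm} {A x y f : Tm} {s r : CTm} {i : ℕ}

theorem eappMin_premise (hΓ : Ctx Ξ Φ Γ)
    (hf : JEq Ξ Φ Γ f f (hom A x y)) (hs : CubeHas Ξ s .two) (hr : CubeHas Ξ r .two) :
    JEq Ξ (.and (.le s r) (.le r s) :: Φ) Γ (.eapp f s) (.eapp f r) A := by
  have hwf : TopeWf Ξ (.and (.le s r) (.le r s)) := .and (.le hs hr) (.le hr hs)
  have hh : Entails Ξ (.and (.le s r) (.le r s) :: Φ) (.and (.le s r) (.le r s)) :=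
    .hyp List.mem_cons_self
  exact (hf.tope hΓ hwf).eappHom_eq (hΓ.tope hwf) hs hr (.leAntisymm (.andE₁ hh) (.andE₂ hh))

theorem JEq.eappMin_self (hΓ : Ctx Ξ Φ Γ) (hA : JEq Ξ Φ Γ A A (.univ i))
    (hf : JEq Ξ Φ Γ f f (hom A x y)) (hs : CubeHas Ξ s .two) (hr : CubeHas Ξ r .two) :
    JEq Ξ Φ Γ (eappMin f s r) (eappMin f s r) A :=
  .recOr (.leTotal hs hr) hA ((hf.eappHom hs).tope hΓ (.le hs hr))
    ((hf.eappHom hr).tope hΓ (.le hr hs)) (eappMin_premise hΓ hf hs hr)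

theorem JEq.eappMin_left (hΓ : Ctx Ξ Φ Γ) (hA : JEq Ξ Φ Γ A A (.univ i))
    (hf : JEq Ξ Φ Γ f f (hom A x y)) (hs : CubeHas Ξ s .two) (hr : CubeHas Ξ r .two)
    (h : Entails Ξ Φ (.le s r)) : JEq Ξ Φ Γ (eappMin f s r) (.eapp f s) A :=
  .cut hΓ h <| .recOrBeta₁ (.leTotal hs hr) hA ((hf.eappHom hs).tope hΓ (.le hs hr))
    ((hf.eappHom hr).tope hΓ (.le hr hs)) (eappMin_premise hΓ hf hs hr)

theorem JEq.eappMin_right (hΓ : Ctx Ξ Φ Γ) (hA : JEq Ξ Φ Γ A A (.univ i))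
    (hf : JEq Ξ Φ Γ f f (hom A x y)) (hs : CubeHas Ξ s .two) (hr : CubeHas Ξ r .two)
    (h : Entails Ξ Φ (.le r s)) : JEq Ξ Φ Γ (eappMin f s r) (.eapp f r) A :=
  .cut hΓ h <| .recOrBeta₂ (.leTotal hs hr) hA ((hf.eappHom hs).tope hΓ (.le hs hr))
    ((hf.eappHom hr).tope hΓ (.le hr hs)) (eappMin_premise hΓ hf hs hr)

theorem conn_eq_elam {b : Tm} (hΓ : Ctx Ξ Φ Γ) (hA : JEq Ξ Φ Γ A A (.univ i))
    (hx : JEq Ξ Φ Γ x x A) (hy : JEq Ξ Φ Γ y y A) (hf : JEq Ξ Φ Γ f f (hom A x y))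
    (hr : CubeHas Ξ r .two)
    (hb : JEq (.two :: Ξ) (extTopes Φ .top) (wkCtx Γ)
      (eappMin f.wkCube (.var 0) (r.ren Nat.succ)) b A.wkCube) :
    JEq Ξ Φ Γ (conn f r) (.elam .two .top b) (hom A x (.eapp f r)) := by
  have hf' {ψ : Tope} (hψ : TopeWf (.two :: Ξ) ψ) := hom_wkCube A x y ▸ hf.wkExt hΓ hψ
  refine (SectEq.ofHom hΓ hA hx (hf.eappHom hr)).elam_congr hb ?_ ?_
  · have h₀ : Entails (.two :: Ξ) (extTopes Φ atZero) atZero := .hyp mem_extTopes_head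
    refine (JEq.eappMin_left (hΓ.ext atZero_wf) (hA.wkExt hΓ atZero_wf) (hf' atZero_wf)
      (.var rfl) hr.wk ?_).trans ?_
    · exact .leTrans (.le_of_eq (.var rfl) .zero (.eqSymm h₀)) (.zeroLe hr.wk)
    · exact (hf' atZero_wf).eappHom_zero (hΓ.ext atZero_wf) (hA.wkExt hΓ atZero_wf)
        (hx.wkExt hΓ atZero_wf) (hy.wkExt hΓ atZero_wf) (.var rfl) h₀
  · have h₁ : Entails (.two :: Ξ) (extTopes Φ atOne) atOne := .hyp mem_extTopes_head
    refine JEq.eappMin_right (hΓ.ext atOne_wf) (hA.wkExt hΓ atOne_wf) (hf' atOne_wf)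
      (.var rfl) hr.wk ?_
    exact .leTrans (.leOne hr.wk) (.le_of_eq .one (.var rfl) (.eqSymm h₁))

theorem JEq.conn_self (hΓ : Ctx Ξ Φ Γ) (hA : JEq Ξ Φ Γ A A (.univ i))
    (hx : JEq Ξ Φ Γ x x A) (hy : JEq Ξ Φ Γ y y A) (hf : JEq Ξ Φ Γ f f (hom A x y))
    (hr : CubeHas Ξ r .two) :
    JEq Ξ Φ Γ (conn f r) (conn f r) (hom A x (.eapp f r)) :=
  conn_eq_elam hΓ hA hx hy hf hr
    (.eappMin_self (hΓ.ext .top) (hA.wkExt hΓ .top) (hom_wkCube A x y ▸ hf.wkExt hΓ .top)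
      (.var rfl) hr.wk)

theorem JEq.conn_zero (hΓ : Ctx Ξ Φ Γ) (hA : JEq Ξ Φ Γ A A (.univ i))
    (hx : JEq Ξ Φ Γ x x A) (hy : JEq Ξ Φ Γ y y A) (hf : JEq Ξ Φ Γ f f (hom A x y))
    (hr : CubeHas Ξ r .two) (h : Entails Ξ Φ (.eq .zero r)) :
    JEq Ξ Φ Γ (conn f r) (idArrow x) (hom A x (.eapp f r)) := by
  have hΓ' := hΓ.ext (TopeWf.top (Ξ := .two :: Ξ))
  have hA' := hA.wkExt hΓ (TopeWf.top (Ξ := .two :: Ξ))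
  have hf' := hom_wkCube A x y ▸ hf.wkExt hΓ (TopeWf.top (Ξ := .two :: Ξ))
  have h' : Entails (.two :: Ξ) (extTopes Φ .top) (.eq .zero (r.ren Nat.succ)) := h.wkExt
  refine conn_eq_elam hΓ hA hx hy hf hr ((JEq.eappMin_right hΓ' hA' hf' (.var rfl) hr.wk ?_).trans
    (hf'.eappHom_zero hΓ' hA' (hx.wkExt hΓ .top) (hy.wkExt hΓ .top) hr.wk h'))
  exact .leTrans (.le_of_eq hr.wk .zero (.eqSymm h')) (.zeroLe (.var rfl))

theorem JEq.conn_one (hΓ : Ctx Ξ Φ Γ) (hA : JEq Ξ Φ Γ A A (.univ i))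
    (hx : JEq Ξ Φ Γ x x A) (hy : JEq Ξ Φ Γ y y A) (hf : JEq Ξ Φ Γ f f (hom A x y))
    (hr : CubeHas Ξ r .two) (h : Entails Ξ Φ (.eq r .one)) :
    JEq Ξ Φ Γ (conn f r) f (hom A x (.eapp f r)) := by
  have hΓ' := hΓ.ext (TopeWf.top (Ξ := .two :: Ξ))
  have hA' := hA.wkExt hΓ (TopeWf.top (Ξ := .two :: Ξ))
  have hf' := hom_wkCube A x y ▸ hf.wkExt hΓ (TopeWf.top (Ξ := .two :: Ξ))
  have h' : Entails (.two :: Ξ) (extTopes Φ .top) (.eq (r.ren Nat.succ) .one) := h.wkExt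
  refine (conn_eq_elam hΓ hA hx hy hf hr (JEq.eappMin_left hΓ' hA' hf' (.var rfl) hr.wk ?_)).trans
    ((JEq.extEta hf).symm.conv (JEq.hom_congr hΓ hA hx
      (hf.eappHom_one hΓ hA hx hy hr h).symm))
  exact .leTrans (.leOne (.var rfl)) (.le_of_eq .one hr.wk (.eqSymm h'))

end

/-! ### Families over a type -/

/-- `A` is a type and `C` a family of types over `A`. -/
structure Fam (Ξ : List Cube) (Φ : List Tope) (Γ : List Tm) (A C : Tm) (i j : ℕ) : Prop where
  ctx : Ctx Ξ Φ Γ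
  base : JEq Ξ Φ Γ A A (.univ i)
  fam : JEq Ξ Φ Γ C C (arrow A (.univ j))

section

variable {Ξ : List Cube} {Φ : List Tope} {Γ : List Tm} {A C c a x x' y f u v φ : Tm} {r : CTm}
  {i j : ℕ}

theorem Fam.wkExt {ψ : Tope} (h : Fam Ξ Φ Γ A C i j) (hψ : TopeWf (.two :: Ξ) ψ) :
    Fam (.two :: Ξ) (extTopes Φ ψ) (wkCtx Γ) A.wkCube C.wkCube i j :=
  ⟨h.ctx.ext hψ, h.base.wkExt h.ctx hψ, by simpa using h.fam.wkExt h.ctx hψ⟩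

theorem Fam.wk {B : Tm} {k : ℕ} (h : Fam Ξ Φ Γ A C i j) (hB : JEq Ξ Φ Γ B B (.univ k)) :
    Fam Ξ Φ (B :: Γ) (A.wk 1) (C.wk 1) i j :=
  ⟨.cons h.ctx hB, h.base.wk (.cons h.ctx hB), by simpa using h.fam.wk (.cons h.ctx hB)⟩

theorem Fam.app (h : Fam Ξ Φ Γ A C i j) (hx : JEq Ξ Φ Γ x x' A) :
    JEq Ξ Φ Γ (.app C x) (.app C x') (.univ j) := by
  simpa using h.fam.app hx

theorem Fam.app_eapp (h : Fam Ξ Φ Γ A C i j) (hf : JEq Ξ Φ Γ f f (hom A x y))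
    (hr : CubeHas Ξ r .two) : JEq Ξ Φ Γ (.app C (.eapp f r)) (.app C (.eapp f r)) (.univ j) :=
  h.app (hf.eappHom hr)

theorem Fam.sectEq (h : Fam Ξ Φ Γ A C i j) (hx : JEq Ξ Φ Γ x x A) (hy : JEq Ξ Φ Γ y y A)
    (hf : JEq Ξ Φ Γ f f (hom A x y)) (hu : JEq Ξ Φ Γ u u (.app C x))
    (hv : JEq Ξ Φ Γ v v (.app C y)) :
    SectEq Ξ Φ Γ (.app C.wkCube (.eapp f.wkCube (.var 0))) u u v v j := by
  have hf' {ψ : Tope} (hψ : TopeWf (.two :: Ξ) ψ) := hom_wkCube A x y ▸ hf.wkExt h.ctx hψ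
  have h0 := h.wkExt atZero_wf
  have h1 := h.wkExt atOne_wf
  refine ⟨h.ctx, (h.wkExt .top).app_eapp (hf' .top) (.var rfl), ?_, ?_⟩
  · exact (hu.wkExt h.ctx atZero_wf).conv (h0.app ((hf' atZero_wf).eappHom_zero h0.ctx h0.base
      (hx.wkExt h.ctx atZero_wf) (hy.wkExt h.ctx atZero_wf) (.var rfl)
      (.hyp mem_extTopes_head)).symm)
  · exact (hv.wkExt h.ctx atOne_wf).conv (h1.app ((hf' atOne_wf).eappHom_one h1.ctx h1.base
      (hx.wkExt h.ctx atOne_wf) (hy.wkExt h.ctx atOne_wf) (.var rfl)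
      (.hyp mem_extTopes_head)).symm)

theorem Fam.dhom_form (h : Fam Ξ Φ Γ A C i j) (hx : JEq Ξ Φ Γ x x A) (hy : JEq Ξ Φ Γ y y A)
    (hf : JEq Ξ Φ Γ f f (hom A x y)) (hu : JEq Ξ Φ Γ u u (.app C x))
    (hv : JEq Ξ Φ Γ v v (.app C y)) :
    JEq Ξ Φ Γ (dhom C f u v) (dhom C f u v) (.univ j) :=
  (h.sectEq hx hy hf hu hv).form

/-- A constant arrow of a family, over an identity arrow. -/
theorem Fam.constArrow (h : Fam Ξ Φ Γ A C i j) (hx : JEq Ξ Φ Γ x x A)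
    (hu : JEq Ξ Φ Γ u u (.app C x)) :
    JEq Ξ Φ Γ (.elam .two .top u.wkCube) (.elam .two .top u.wkCube)
      (dhom C (idArrow x) u u) := by
  have hs := h.sectEq hx hx (.idArrow_congr h.ctx h.base hx) hu hu
  refine hs.elam_congr ?_ hs.src hs.tgt
  refine (hu.wkExt h.ctx .top).conv ((h.wkExt .top).app ?_).symm
  have := (SectEq.ofHom (h.wkExt .top).ctx (h.wkExt .top).base (hx.wkExt h.ctx .top)
    (hx.wkExt h.ctx .top)).beta (((hx.wkExt h.ctx .top)).wkExt (h.wkExt .top).ctx .top)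
    (s := .var 0) (.var rfl)
  simpa [idArrow, Tm.ren_eq_subst] using this

/-! ### Natural families of maps out of a representable -/

theorem Fam.repMaps_form (h : Fam Ξ Φ Γ A C i j) (ha : JEq Ξ Φ Γ a a A) :
    JEq Ξ Φ Γ (repMaps A C a) (repMaps A C a) (.univ (max i j)) := by
  have h₁ := h.wk h.base
  have hx : JEq Ξ Φ (A :: Γ) (.var 0) (.var 0) (A.wk 1) := .var_zero h₁.ctx
  have hh := JEq.hom_congr h₁.ctx h₁.base (ha.wk h₁.ctx) hx
  exact .pi (.cumul (le_max_left _ _) h.base) (.pi (.cumul (le_max_left _ _) hh)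
    (.cumul (le_max_right _ _) ((h₁.app hx).wk (.cons h₁.ctx hh))))

theorem JEq.appRep {φ φ' g g' : Tm} (hφ : JEq Ξ Φ Γ φ φ' (repMaps A C a))
    (hx : JEq Ξ Φ Γ x x' A) (hg : JEq Ξ Φ Γ g g' (hom A a x)) :
    JEq Ξ Φ Γ (.app (.app φ x) g) (.app (.app φ' x') g') (.app C x) := by
  have h₁ : JEq Ξ Φ Γ (.app φ x) (.app φ' x') (arrow (hom A a x) (.app C x)) := by
    simpa using hφ.app hx
  simpa using h₁.app hg

/-- The image under `φ` of the connection square of `f`. -/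
def naturality (φ f : Tm) : Tm :=
  .elam .two .top (.app (.app φ.wkCube (.eapp f.wkCube (.var 0))) (conn f.wkCube (.var 0)))

theorem Fam.naturality_typed (h : Fam Ξ Φ Γ A C i j) (ha : JEq Ξ Φ Γ a a A) (hx : JEq Ξ Φ Γ x x A)
    (hf : JEq Ξ Φ Γ f f (hom A a x)) (hφ : JEq Ξ Φ Γ φ φ (repMaps A C a)) :
    JEq Ξ Φ Γ (naturality φ f) (naturality φ f)
      (dhom C f (.app (.app φ a) (idArrow a)) (.app (.app φ x) f)) := by
  have hs := h.sectEq ha hx hf (hφ.appRep ha (.idArrow_congr h.ctx h.base ha)) (hφ.appRep hx hf)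
  have hf' {ψ : Tope} (hψ : TopeWf (.two :: Ξ) ψ) := hom_wkCube A a x ▸ hf.wkExt h.ctx hψ
  have hφ' {ψ : Tope} (hψ : TopeWf (.two :: Ξ) ψ) : JEq (.two :: Ξ) (extTopes Φ ψ) (wkCtx Γ)
      φ.wkCube φ.wkCube (repMaps A.wkCube C.wkCube a.wkCube) := by
    simpa using hφ.wkExt h.ctx hψ
  refine hs.elam_congr ?_ ?_ ?_
  · exact (hφ' .top).appRep ((hf' .top).eappHom (.var rfl))
      (.conn_self (h.wkExt .top).ctx (h.wkExt .top).base (ha.wkExt h.ctx .top) (hx.wkExt h.ctx .top)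
        (hf' .top) (.var rfl))
  · have h₀ := h.wkExt atZero_wf
    have hz : Entails (.two :: Ξ) (extTopes Φ atZero) (.eq .zero (.var 0)) :=
      .hyp mem_extTopes_head
    have ha₀ := ha.wkExt h.ctx (atZero_wf (Ξ := Ξ))
    have hx₀ := hx.wkExt h.ctx (atZero_wf (Ξ := Ξ))
    have hc := JEq.conn_zero h₀.ctx h₀.base ha₀ hx₀ (hf' atZero_wf) (.var rfl) hz
    rw [← idArrow_wkCube] at hc
    exact (hφ' atZero_wf).appRep
      ((hf' atZero_wf).eappHom_zero h₀.ctx h₀.base ha₀ hx₀ (.var rfl) hz)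
      hc
  · have h₁ := h.wkExt atOne_wf
    have ho : Entails (.two :: Ξ) (extTopes Φ atOne) (.eq (.var 0) .one) :=
      .hyp mem_extTopes_head
    have ha₁ := ha.wkExt h.ctx (atOne_wf (Ξ := Ξ))
    have hx₁ := hx.wkExt h.ctx (atOne_wf (Ξ := Ξ))
    exact (hφ' atOne_wf).appRep
      ((hf' atOne_wf).eappHom_one h₁.ctx h₁.base ha₁ hx₁ (.var rfl) ho)
      (.conn_one h₁.ctx h₁.base ha₁ hx₁ (hf' atOne_wf) (.var rfl) ho)

end

section

variable {Ξ : List Cube} {Φ : List Tope} {Γ : List Tm} {A B C D S W X Y a c f g p q s u v w x y z φ : Tm}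
  {i j k : ℕ}

/-! ### Contractible types and identity types -/

theorem JEq.contrPath (hw : JEq Ξ Φ Γ w w (isContr S)) (hz : JEq Ξ Φ Γ z z S) :
    JEq Ξ Φ Γ (.app (.snd w) z) (.app (.snd w) z) (.id S (.fst w) z) := by
  have : JEq Ξ Φ Γ (.snd w) (.snd w) (.pi S (.id (S.wk 1) (.wk 1 (.fst w)) (.var 0))) := by
    simpa using JEq.snd hw
  simpa using this.app hz

theorem JEq.apFst (hΓ : Ctx Ξ Φ Γ) (hB : JEq Ξ Φ Γ B B (.univ i))
    (hD : JEq Ξ Φ (B :: Γ) D D (.univ i)) (hs : JEq Ξ Φ Γ s s (.sigma B D))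
    (hp : JEq Ξ Φ Γ p p (.id (.sigma B D) s z)) :
    ∃ q, JEq Ξ Φ Γ q q (.id B (.fst s) (.fst z)) := by
  have hS := JEq.sigma hB hD
  have hΓ₁ := Ctx.cons hΓ hS
  have hI := JEq.id (hS.wk hΓ₁) (hs.wk hΓ₁) (.var_zero hΓ₁)
  have hΓ₂ := Ctx.cons hΓ₁ hI
  have hv : JEq Ξ Φ (.id (.wk 1 (.sigma B D)) (s.wk 1) (.var 0) :: .sigma B D :: Γ)
      (.var 1) (.var 1) (.sigma ((B.wk 1).wk 1) (.subst CTm.var (upTm fun n => .var (n + 2)) D)) := by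
    simpa using JEq.var (n := 1) hΓ₂ rfl
  have hC := JEq.id ((hB.wk hΓ₁).wk hΓ₂) ((hs.fst.wk hΓ₁).wk hΓ₂) hv.fst
  exact ⟨_, by simpa using JEq.idrec (d := .refl (.fst s)) hs hC (by simpa using hs.fst.refl) hp⟩

theorem JEq.funext_intro (hA : JEq Ξ Φ Γ A A (.univ i)) (hf : JEq Ξ Φ Γ f f (.pi A B))
    (hg : JEq Ξ Φ Γ g g (.pi A B))
    (h : ∃ p, JEq Ξ Φ (A :: Γ) p p (.id B (.app (f.wk 1) (.var 0)) (.app (g.wk 1) (.var 0)))) :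
    ∃ p, JEq Ξ Φ Γ p p (.id (.pi A B) f g) :=
  let ⟨_, hp⟩ := h
  ⟨_, .funext hf hg (.lam hA hp)⟩

/-! ### Transport in a covariant family -/

theorem JEq.isCovariant_app (hc : JEq Ξ Φ Γ c c (isCovariant A C)) (hx : JEq Ξ Φ Γ x x A)
    (hy : JEq Ξ Φ Γ y y A) (hf : JEq Ξ Φ Γ f f (hom A x y)) (hu : JEq Ξ Φ Γ u u (.app C x)) :
    JEq Ξ Φ Γ (.app (.app (.app (.app c x) y) f) u) (.app (.app (.app (.app c x) y) f) u)
      (isContr (.sigma (.app C y) (dhom (C.wk 1) (f.wk 1) (u.wk 1) (.var 0)))) := by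
  have h₁ : JEq Ξ Φ Γ (.app c x) (.app c x) (.pi A (.pi (hom (A.wk 1) (x.wk 1) (.var 0))
      (.pi (.app (C.wk 2) (x.wk 2)) (isContr (.sigma (.app (C.wk 3) (.var 2))
        (dhom (C.wk 4) (.var 2) (.var 1) (.var 0))))))) := by
    simpa using hc.app hx
  have h₂ : JEq Ξ Φ Γ (.app (.app c x) y) (.app (.app c x) y) (.pi (hom A x y)
      (.pi (.app (C.wk 1) (x.wk 1)) (isContr (.sigma (.app (C.wk 2) (y.wk 2))
        (dhom (C.wk 3) (.var 2) (.var 1) (.var 0)))))) := by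
    simpa using h₁.app hy
  have h₃ : JEq Ξ Φ Γ (.app (.app (.app c x) y) f) (.app (.app (.app c x) y) f)
      (.pi (.app C x) (isContr (.sigma (.app (C.wk 1) (y.wk 1))
        (dhom (C.wk 2) (f.wk 2) (.var 1) (.var 0))))) := by
    simpa using h₂.app hf
  simpa using h₃.app hu

theorem JEq.covTransport_typed (hc : JEq Ξ Φ Γ c c (isCovariant A C)) (hx : JEq Ξ Φ Γ x x A)
    (hy : JEq Ξ Φ Γ y y A) (hf : JEq Ξ Φ Γ f f (hom A x y)) (hu : JEq Ξ Φ Γ u u (.app C x)) :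
    JEq Ξ Φ Γ (covTransport c x y f u) (covTransport c x y f u) (.app C y) :=
  (hc.isCovariant_app hx hy hf hu).fst.fst

/-- An arrow over `f` from `u` to `v` identifies `f_* u` with `v`. -/
theorem Fam.covTransport_unique (h : Fam Ξ Φ Γ A C i j)
    (hc : JEq Ξ Φ Γ c c (isCovariant A C)) (hx : JEq Ξ Φ Γ x x A)
    (hy : JEq Ξ Φ Γ y y A) (hf : JEq Ξ Φ Γ f f (hom A x y)) (hu : JEq Ξ Φ Γ u u (.app C x))
    (hv : JEq Ξ Φ Γ v v (.app C y)) (hw : JEq Ξ Φ Γ w w (dhom C f u v)) :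
    ∃ p, JEq Ξ Φ Γ p p (.id (.app C y) (covTransport c x y f u) v) := by
  have hW := hc.isCovariant_app hx hy hf hu
  have hCy := h.app hy
  have h₁ := h.wk hCy
  have hD : JEq Ξ Φ (.app C y :: Γ) (dhom (C.wk 1) (f.wk 1) (u.wk 1) (.var 0))
      (dhom (C.wk 1) (f.wk 1) (u.wk 1) (.var 0)) (.univ j) :=
    h₁.dhom_form (hx.wk h₁.ctx) (hy.wk h₁.ctx) (by simpa using hf.wk h₁.ctx) (hu.wk h₁.ctx)
      (.var_zero h₁.ctx)
  have hw' : JEq Ξ Φ Γ w w (Tm.inst (dhom (C.wk 1) (f.wk 1) (u.wk 1) (.var 0)) v) := by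
    simpa using hw
  obtain ⟨q, hq⟩ := JEq.apFst h.ctx hCy hD hW.fst (hW.contrPath (.pair hD hv hw'))
  exact ⟨q, hq.conv (.id hCy hW.fst.fst (.fstBeta hD hv hw'))⟩

end

/-! ### The Yoneda maps -/

/-- A covariant family over a pointed type. -/
structure CovFam (Ξ : List Cube) (Φ : List Tope) (Γ : List Tm) (A C c a : Tm) (i j : ℕ) : Prop
    extends Fam Ξ Φ Γ A C i j where
  cov : JEq Ξ Φ Γ c c (isCovariant A C)
  pt : JEq Ξ Φ Γ a a A

section

variable {Ξ : List Cube} {Φ : List Tope} {Γ : List Tm} {A B C X Y a c f g p q u u' x y φ φ' : Tm}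
  {i j k : ℕ}

theorem CovFam.weaken (h : CovFam Ξ Φ Γ A C c a i j) (hB : JEq Ξ Φ Γ B B (.univ k)) :
    CovFam Ξ Φ (B :: Γ) (A.wk 1) (C.wk 1) (c.wk 1) (a.wk 1) i j :=
  ⟨h.wk hB, by simpa using h.cov.wk (.cons h.ctx hB), h.pt.wk (.cons h.ctx hB)⟩

theorem Fam.evid_body (h : Fam Ξ Φ Γ A C i j) (ha : JEq Ξ Φ Γ a a A) :
    JEq Ξ Φ (repMaps A C a :: Γ) (.app (.app (.var 0) (a.wk 1)) (idArrow (a.wk 1)))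
      (.app (.app (.var 0) (a.wk 1)) (idArrow (a.wk 1))) (.wk 1 (.app C a)) := by
  have h₁ := h.wk (h.repMaps_form ha)
  have ha₁ := ha.wk h₁.ctx
  have hv : JEq Ξ Φ (repMaps A C a :: Γ) (.var 0) (.var 0)
      (repMaps (A.wk 1) (C.wk 1) (a.wk 1)) := by
    simpa using JEq.var_zero h₁.ctx
  exact hv.appRep ha₁ (.idArrow_congr h₁.ctx h₁.base ha₁)

theorem Fam.evid_typed (h : Fam Ξ Φ Γ A C i j) (ha : JEq Ξ Φ Γ a a A) :
    JEq Ξ Φ Γ (evid A C a) (evid A C a) (arrow (repMaps A C a) (.app C a)) :=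
  .lam (h.repMaps_form ha) (h.evid_body ha)

theorem Fam.evid_app (h : Fam Ξ Φ Γ A C i j) (ha : JEq Ξ Φ Γ a a A)
    (hφ : JEq Ξ Φ Γ φ φ (repMaps A C a)) :
    JEq Ξ Φ Γ (.app (evid A C a) φ) (.app (.app φ a) (idArrow a)) (.app C a) := by
  simpa [evid] using JEq.piBeta (h.evid_body ha) hφ

/-- The value `λ x, λ f, f_* u` of `yon` at `u`. -/
def yonAt (A c a u : Tm) : Tm :=
  .lam A <| .lam (hom (A.wk 1) (a.wk 1) (.var 0)) <|
    covTransport (c.wk 2) (a.wk 2) (.var 1) (.var 0) (u.wk 2)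

theorem CovFam.yonAt_body₂ (h : CovFam Ξ Φ Γ A C c a i j) (hx : JEq Ξ Φ Γ x x A)
    (hu : JEq Ξ Φ Γ u u (.app C a)) :
    JEq Ξ Φ (hom A a x :: Γ) (covTransport (c.wk 1) (a.wk 1) (x.wk 1) (.var 0) (u.wk 1))
      (covTransport (c.wk 1) (a.wk 1) (x.wk 1) (.var 0) (u.wk 1)) (.wk 1 (.app C x)) := by
  have h₁ := h.weaken (.hom_congr h.ctx h.base h.pt hx)
  exact h₁.cov.covTransport_typed h₁.pt (hx.wk h₁.ctx)
    (by simpa using JEq.var_zero h₁.ctx) (hu.wk h₁.ctx)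

theorem CovFam.yonAt_body₁ (h : CovFam Ξ Φ Γ A C c a i j) (hu : JEq Ξ Φ Γ u u (.app C a)) :
    JEq Ξ Φ (A :: Γ)
      (.lam (hom (A.wk 1) (a.wk 1) (.var 0))
        (covTransport (c.wk 2) (a.wk 2) (.var 1) (.var 0) (u.wk 2)))
      (.lam (hom (A.wk 1) (a.wk 1) (.var 0))
        (covTransport (c.wk 2) (a.wk 2) (.var 1) (.var 0) (u.wk 2)))
      (arrow (hom (A.wk 1) (a.wk 1) (.var 0)) (.app (C.wk 1) (.var 0))) := by
  have h₁ := h.weaken h.base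
  have hx : JEq Ξ Φ (A :: Γ) (.var 0) (.var 0) (A.wk 1) := .var_zero h₁.ctx
  have := JEq.lam (.hom_congr h₁.ctx h₁.base h₁.pt hx) (h₁.yonAt_body₂ hx (hu.wk h₁.ctx))
  simpa [arrow] using this

theorem CovFam.yonAt_typed (h : CovFam Ξ Φ Γ A C c a i j) (hu : JEq Ξ Φ Γ u u (.app C a)) :
    JEq Ξ Φ Γ (yonAt A c a u) (yonAt A c a u) (repMaps A C a) :=
  .lam h.base (h.yonAt_body₁ hu)

theorem CovFam.yonAt_app (h : CovFam Ξ Φ Γ A C c a i j) (hu : JEq Ξ Φ Γ u u (.app C a))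
    (hx : JEq Ξ Φ Γ x x A) (hf : JEq Ξ Φ Γ f f (hom A a x)) :
    JEq Ξ Φ Γ (.app (.app (yonAt A c a u) x) f) (covTransport c a x f u) (.app C x) := by
  have h₁ : JEq Ξ Φ Γ (.app (yonAt A c a u) x) (.lam (hom A a x)
      (covTransport (c.wk 1) (a.wk 1) (x.wk 1) (.var 0) (u.wk 1)))
      (arrow (hom A a x) (.app C x)) := by
    simpa [yonAt] using JEq.piBeta (h.yonAt_body₁ hu) hx
  have h₂ := (h₁.app hf).trans (.piBeta (h.yonAt_body₂ hx hu) hf)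
  simpa using h₂

theorem CovFam.yon_body (h : CovFam Ξ Φ Γ A C c a i j) :
    JEq Ξ Φ (.app C a :: Γ) (yonAt (A.wk 1) (c.wk 1) (a.wk 1) (.var 0))
      (yonAt (A.wk 1) (c.wk 1) (a.wk 1) (.var 0)) (.wk 1 (repMaps A C a)) := by
  have h₁ := h.weaken (h.app h.pt)
  simpa using h₁.yonAt_typed (u := .var 0) (.var_zero h₁.ctx)

theorem yon_eq (A C c a : Tm) :
    yon A C c a = .lam (.app C a) (yonAt (A.wk 1) (c.wk 1) (a.wk 1) (.var 0)) := by
  simp [yon, yonAt]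

theorem CovFam.yon_typed (h : CovFam Ξ Φ Γ A C c a i j) :
    JEq Ξ Φ Γ (yon A C c a) (yon A C c a) (arrow (.app C a) (repMaps A C a)) := by
  rw [yon_eq]
  exact .lam (h.app h.pt) h.yon_body

theorem CovFam.yon_app (h : CovFam Ξ Φ Γ A C c a i j) (hu : JEq Ξ Φ Γ u' u (.app C a)) :
    JEq Ξ Φ Γ (.app (yon A C c a) u') (yonAt A c a u) (repMaps A C a) := by
  rw [yon_eq]
  refine JEq.trans (b := .app (.lam (.app C a) (yonAt (A.wk 1) (c.wk 1) (a.wk 1) (.var 0))) u)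
    ?_ ?_
  · simpa using JEq.app (JEq.lam (h.app h.pt) h.yon_body) hu
  · simpa [yonAt] using JEq.piBeta h.yon_body hu.right

theorem CovFam.yon_app_app (h : CovFam Ξ Φ Γ A C c a i j) (hu : JEq Ξ Φ Γ u' u (.app C a))
    (hx : JEq Ξ Φ Γ x x A) (hf : JEq Ξ Φ Γ f f (hom A a x)) :
    JEq Ξ Φ Γ (.app (.app (.app (yon A C c a) u') x) f) (covTransport c a x f u) (.app C x) :=
  ((h.yon_app hu).appRep hx hf).trans (h.yonAt_app hu.right hx hf)

theorem CovFam.evid_yon (h : CovFam Ξ Φ Γ A C c a i j) (hu : JEq Ξ Φ Γ u u (.app C a)) :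
    ∃ p, JEq Ξ Φ Γ p p
      (.id (.app C a) (.app (evid A C a) (.app (yon A C c a) u)) u) := by
  have hid := JEq.idArrow_congr h.ctx h.base h.pt
  obtain ⟨p, hp⟩ := h.covTransport_unique h.cov h.pt h.pt hid hu hu (h.constArrow h.pt hu)
  refine ⟨p, hp.conv (.id (h.app h.pt) (.symm ?_) hu)⟩
  exact (h.evid_app h.pt (h.yon_app hu).left).trans (h.yon_app_app hu h.pt hid)

theorem CovFam.yon_evid_app (h : CovFam Ξ Φ Γ A C c a i j)
    (hφ : JEq Ξ Φ Γ φ φ (repMaps A C a)) (hx : JEq Ξ Φ Γ x x A)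
    (hf : JEq Ξ Φ Γ f f (hom A a x)) :
    ∃ p, JEq Ξ Φ Γ p p (.id (.app C x)
      (.app (.app (.app (yon A C c a) (.app (evid A C a) φ)) x) f) (.app (.app φ x) f)) := by
  have hu := h.evid_app h.pt hφ
  obtain ⟨p, hp⟩ := h.covTransport_unique h.cov h.pt hx hf hu.right (hφ.appRep hx hf)
    (h.naturality_typed h.pt hx hf hφ)
  exact ⟨p, hp.conv (.id (h.app hx) (h.yon_app_app hu hx hf).symm (hφ.appRep hx hf))⟩

theorem CovFam.yon_evid (h : CovFam Ξ Φ Γ A C c a i j) (hφ : JEq Ξ Φ Γ φ φ (repMaps A C a)) :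
    ∃ p, JEq Ξ Φ Γ p p
      (.id (repMaps A C a) (.app (yon A C c a) (.app (evid A C a) φ)) φ) := by
  have hψ := (h.yon_app (h.evid_app h.pt hφ)).left
  have h₁ := h.weaken h.base
  have hx : JEq Ξ Φ (A :: Γ) (.var 0) (.var 0) (A.wk 1) := .var_zero h₁.ctx
  have hH := JEq.hom_congr h₁.ctx h₁.base h₁.pt hx
  have h₂ := h₁.weaken hH
  have wk_app {χ : Tm} (hχ : JEq Ξ Φ Γ χ χ (repMaps A C a)) :
      JEq Ξ Φ (A :: Γ) (.app (χ.wk 1) (.var 0)) (.app (χ.wk 1) (.var 0))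
        (arrow (hom (A.wk 1) (a.wk 1) (.var 0)) (.app (C.wk 1) (.var 0))) := by
    have : JEq Ξ Φ (A :: Γ) (χ.wk 1) (χ.wk 1) (repMaps (A.wk 1) (C.wk 1) (a.wk 1)) := by
      simpa using hχ.wk h₁.ctx
    simpa using this.app hx
  refine JEq.funext_intro h.base hψ hφ (JEq.funext_intro hH (wk_app hψ) (wk_app hφ) ?_)
  have hf : JEq Ξ Φ (hom (A.wk 1) (a.wk 1) (.var 0) :: A :: Γ) (.var 0) (.var 0)
      (hom ((A.wk 1).wk 1) ((a.wk 1).wk 1) (.wk 1 (.var 0))) := by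
    simpa using JEq.var_zero h₂.ctx
  simpa using h₂.yon_evid_app (by simpa using (hφ.wk h₁.ctx).wk h₂.ctx) (hx.wk h₂.ctx) hf

/-! ### Equivalences -/

theorem retraction_subst (X f g : Tm) (κ : ℕ → CTm) (σ : ℕ → Tm) :
    (retraction X f g).subst κ σ = retraction (X.subst κ σ) (f.subst κ σ) (g.subst κ σ) := by
  simp [retraction]

theorem JEq.retraction_intro (hX : JEq Ξ Φ Γ X X (.univ i))
    (h : ∃ p, JEq Ξ Φ (X :: Γ) p p
      (.id (X.wk 1) (.app (g.wk 1) (.app (f.wk 1) (.var 0))) (.var 0))) :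
    ∃ p, JEq Ξ Φ Γ p p (retraction X f g) :=
  let ⟨_, hp⟩ := h
  ⟨_, .lam hX hp⟩

theorem JEq.arrow_congr (hΓ : Ctx Ξ Φ Γ) (hX : JEq Ξ Φ Γ X X (.univ i))
    (hY : JEq Ξ Φ Γ Y Y (.univ i)) : JEq Ξ Φ Γ (arrow X Y) (arrow X Y) (.univ i) :=
  .pi hX (hY.wk (.cons hΓ hX))

theorem JEq.retraction_form (hΓ : Ctx Ξ Φ Γ) (hX : JEq Ξ Φ Γ X X (.univ i))
    (hf : JEq Ξ Φ Γ f f (arrow X Y)) (hg : JEq Ξ Φ Γ g g (arrow Y X)) :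
    JEq Ξ Φ Γ (retraction X f g) (retraction X f g) (.univ i) := by
  have hΓ₁ := Ctx.cons hΓ hX
  have hx : JEq Ξ Φ (X :: Γ) (.var 0) (.var 0) (X.wk 1) := .var_zero hΓ₁
  have hf₁ : JEq Ξ Φ (X :: Γ) (f.wk 1) (f.wk 1) (arrow (X.wk 1) (Y.wk 1)) := by
    simpa using hf.wk hΓ₁
  have hg₁ : JEq Ξ Φ (X :: Γ) (g.wk 1) (g.wk 1) (arrow (Y.wk 1) (X.wk 1)) := by
    simpa using hg.wk hΓ₁
  have hfx : JEq Ξ Φ (X :: Γ) (.app (f.wk 1) (.var 0)) (.app (f.wk 1) (.var 0)) (Y.wk 1) := by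
    simpa using hf₁.app hx
  exact .pi hX (.id (hX.wk hΓ₁) (by simpa using hg₁.app hfx) hx)

/-- A function with a two-sided inverse is an equivalence. -/
theorem JEq.isEquiv_intro (hΓ : Ctx Ξ Φ Γ) (hX : JEq Ξ Φ Γ X X (.univ i))
    (hY : JEq Ξ Φ Γ Y Y (.univ i)) (hf : JEq Ξ Φ Γ f f (arrow X Y))
    (hg : JEq Ξ Φ Γ g g (arrow Y X)) (hp : JEq Ξ Φ Γ p p (retraction Y g f))
    (hq : JEq Ξ Φ Γ q q (retraction X f g)) : ∃ e, JEq Ξ Φ Γ e e (isEquiv X Y f) := by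
  have hYX := JEq.arrow_congr hΓ hY hX
  have hΓ₁ := Ctx.cons hΓ hYX
  have hf₁ : JEq Ξ Φ (arrow Y X :: Γ) (f.wk 1) (f.wk 1) (arrow (X.wk 1) (Y.wk 1)) := by
    simpa using hf.wk hΓ₁
  have hg₁ : JEq Ξ Φ (arrow Y X :: Γ) (.var 0) (.var 0) (arrow (Y.wk 1) (X.wk 1)) := by
    simpa using JEq.var_zero hΓ₁
  have hR := JEq.retraction_form hΓ₁ (hY.wk hΓ₁) hg₁ hf₁
  have hL := JEq.retraction_form hΓ₁ (hX.wk hΓ₁) hf₁ hg₁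
  have hr := JEq.pair hR hg (by simpa [retraction_subst] using hp)
  have hl := JEq.pair hL hg (by simpa [retraction_subst] using hq)
  exact ⟨_, .pair ((JEq.sigma hYX hL).wk (.cons hΓ (.sigma hYX hR))) hr (by simpa [retraction_subst] using hl)⟩

end

end STT

theorem mainTheorem2 (Ξ : List STT.Cube) (Φ : List STT.Tope) (Γ : List STT.Tm) (i j : ℕ)
    (A s C c a : STT.Tm)
    (hΓ : STT.Ctx Ξ Φ Γ)
    (hA : STT.HasType Ξ Φ Γ A (.univ i))
    (hs : STT.HasType Ξ Φ Γ s (STT.isSegal A))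
    (hC : STT.HasType Ξ Φ Γ C (STT.arrow A (.univ j)))
    (hc : STT.HasType Ξ Φ Γ c (STT.isCovariant A C))
    (ha : STT.HasType Ξ Φ Γ a A) :
    -- the two maps are well typed
    STT.HasType Ξ Φ Γ (STT.evid A C a) (STT.arrow (STT.repMaps A C a) (.app C a)) ∧
    STT.HasType Ξ Φ Γ (STT.yon A C c a) (STT.arrow (.app C a) (STT.repMaps A C a)) ∧
    -- they are inverse to each other
    (∃ p, STT.HasType Ξ Φ Γ p
      (STT.retraction (STT.repMaps A C a) (STT.evid A C a) (STT.yon A C c a))) ∧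
    (∃ q, STT.HasType Ξ Φ Γ q
      (STT.retraction (.app C a) (STT.yon A C c a) (STT.evid A C a))) ∧
    -- and both are equivalences
    (∃ e, STT.HasType Ξ Φ Γ e
      (STT.isEquiv (STT.repMaps A C a) (.app C a) (STT.evid A C a))) ∧
    (∃ e, STT.HasType Ξ Φ Γ e
      (STT.isEquiv (.app C a) (STT.repMaps A C a) (STT.yon A C c a))) := by
  have h : STT.CovFam Ξ Φ Γ A C c a i j := ⟨⟨hΓ, hA, hC⟩, hc, ha⟩
  have hR := h.repMaps_form ha
  have hCa := h.app ha
  have hE := h.evid_typed ha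
  have hY := h.yon_typed
  obtain ⟨p, hp⟩ : ∃ p, STT.JEq Ξ Φ Γ p p
      (STT.retraction (STT.repMaps A C a) (STT.evid A C a) (STT.yon A C c a)) := by
    refine STT.JEq.retraction_intro hR ?_
    have h₁ := h.weaken hR
    have := h₁.yon_evid (φ := .var 0) (by simpa using STT.JEq.var_zero h₁.ctx)
    simpa using this
  obtain ⟨q, hq⟩ : ∃ q, STT.JEq Ξ Φ Γ q q
      (STT.retraction (.app C a) (STT.yon A C c a) (STT.evid A C a)) := by
    refine STT.JEq.retraction_intro hCa ?_
    have h₁ := h.weaken hCa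
    have := h₁.evid_yon (u := .var 0) (.var_zero h₁.ctx)
    simpa using this
  exact ⟨hE, hY, ⟨p, hp⟩, ⟨q, hq⟩,
    STT.JEq.isEquiv_intro hΓ hR (.cumul (le_max_right i j) hCa) hE hY hq hp,
    STT.JEq.isEquiv_intro hΓ (.cumul (le_max_right i j) hCa) hR hY hE hp hq⟩
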